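/- Let $\mathcal H$ be a complex Hilbert space, $\mathcal B(\mathcal H)$ the algebra of bounded linear operators on $\mathcal H$ with the Loewner order ($A\le B$ iff $\langle (B-A)a,a\rangle\ge 0$ for all $a\in\mathcal H$), and let $J\subseteq\mathbb R$ be an interval. Let $sp(J)$ be the set of all self-adjoint $X\in\mathcal B(\mathcal H)$ whose spectrum is contained in $J$. A continuous function $f:J\to\mathbb R$ is called operator convex (on $\mathcal H$) if $f\left(\frac{X+Y}{2}\right)\le \frac{f(X)+f(Y)}{2}$ for all $X,Y\in sp(J)$, where $f(X)$ is given by the continuous functional calculus. Its operator epigraph is $$\mathrm{OE}(f)=\{(X,Y)\in sp(J)\times\mathcal B(\mathcal H) : f(X)\le Y\}.$$ A subset $\mathcal K$ of a $\mathcal B(\mathcal H)$-bimodule is called $C^*$-convex if $\sum_{i=1}^n C_i^*X_iC_i\in\mathcal K$ whenever $X_1,\dots,X_n\in\mathcal K$ and $C_1,\dots,C_n\in\mathcal B(\mathcal H)$ satisfy $\sum_{i=1}^n C_i^*C_i=I$; here $\mathcal B(\mathcal H)\times\mathcal B(\mathcal H)$ is a bimodule under coordinatewise left and right multiplication. Theorem.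 For every continuous function $f:J\to\mathbb R$, $f$ is operator convex if and only if $\mathrm{OE}(f)$ is $C^*$-convex. -/

import Mathlib

open MulOpposite

/-- `sp(J)`: the bounded self-adjoint operators on the complex Hilbert space `H` whose spectrum is
contained in `J`. (The complex spectrum of a self-adjoint operator is real, and consists exactly of
the points of its spectrum over `ℝ`.) -/
def spOps (H : Type*) [NormedAddCommGroup H] [InnerProductSpace ℂ H] [CompleteSpace H]
    (J : Set ℝ) : Set (H →L[ℂ] H) :=
  {X | IsSelfAdjoint X ∧ spectrum ℝ X ⊆ J}

/-- Operator convexity, on the Hilbert space `H`, of a real function on `J`: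
`f((X+Y)/2) ≤ (f(X)+f(Y))/2` for all `X, Y ∈ sp(J)`. Here `cfc f X` is `f(X)` (continuous
functional calculus, which only sees the values of `f` on the spectrum of `X`) and `≤` is the
Loewner order. -/
def IsOperatorConvex (H : Type*) [NormedAddCommGroup H] [InnerProductSpace ℂ H] [CompleteSpace H]
    (J : Set ℝ) (f : ℝ → ℝ) : Prop :=
  ∀ X ∈ spOps H J, ∀ Y ∈ spOps H J,
    cfc f ((1 / 2 : ℝ) • (X + Y)) ≤ (1 / 2 : ℝ) • (cfc f X + cfc f Y)

/-- The operator epigraph `OE(f) = {(X, Y) ∈ sp(J) × B(H) : f(X) ≤ Y}`. -/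
def operatorEpigraph (H : Type*) [NormedAddCommGroup H] [InnerProductSpace ℂ H] [CompleteSpace H]
    (J : Set ℝ) (f : ℝ → ℝ) : Set ((H →L[ℂ] H) × (H →L[ℂ] H)) :=
  {p | p.1 ∈ spOps H J ∧ cfc f p.1 ≤ p.2}

/-- A subset `K` of an `A`-bimodule `M` is C⋆-convex if `∑ Cᵢ⋆ Xᵢ Cᵢ ∈ K` for all `Xᵢ ∈ K` and
all `Cᵢ ∈ A` with `∑ Cᵢ⋆ Cᵢ = 1`. The right action of `A` is the action of `Aᵐᵒᵖ`. -/
def IsCStarConvex (A : Type*) {M : Type*} [Semiring A] [StarRing A] [AddCommMonoid M]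
    [Module A M] [Module Aᵐᵒᵖ M] [SMulCommClass A Aᵐᵒᵖ M] (K : Set M) : Prop :=
  ∀ (n : ℕ) (X : Fin n → M) (C : Fin n → A), (∀ i, X i ∈ K) → ∑ i, star (C i) * C i = 1 →
    ∑ i, op (C i) • (star (C i) • X i) ∈ K

/-- On pairs of operators the bimodule action is coordinatewise multiplication. -/
theorem isCStarConvex_prod_iff {H : Type*} [NormedAddCommGroup H] [InnerProductSpace ℂ H]
    [CompleteSpace H] (K : Set ((H →L[ℂ] H) × (H →L[ℂ] H))) :
    IsCStarConvex (H →L[ℂ] H) K ↔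
      ∀ (n : ℕ) (X Y C : Fin n → (H →L[ℂ] H)), (∀ i, (X i, Y i) ∈ K) →
        ∑ i, star (C i) * C i = 1 →
        (∑ i, star (C i) * X i * C i, ∑ i, star (C i) * Y i * C i) ∈ K := by
  have key : ∀ (n : ℕ) (X : Fin n → (H →L[ℂ] H) × (H →L[ℂ] H)) (C : Fin n → (H →L[ℂ] H)),
      ∑ i, op (C i) • (star (C i) • X i) =
        (∑ i, star (C i) * (X i).1 * C i, ∑ i, star (C i) * (X i).2 * C i) := by
    intro n X C
    ext1 <;> simp [Prod.fst_sum, Prod.snd_sum]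
  constructor
  · intro h n X Y C hK hC
    simpa only [key] using h n (fun i => (X i, Y i)) C hK hC
  · intro h n X C hK hC
    rw [key]
    exact h n (fun i => (X i).1) (fun i => (X i).2) C hK hC

/-! Everything rests on Jensen's operator inequality `OperatorJensen`. Granted it, the epigraph is
C⋆-convex, because Y ↦ C⋆YC is monotone and sp(J) is C⋆-convex. Conversely, the coefficients 1/√2,
1/√2 applied to (X, f(X)) and (Y, f(Y)) give midpoint convexity. Convexity is assumed on the single
space H, so passing to a sum of copies of H is possible only in infinite dimension, and the two
cases need different proofs.

Infinite dimension: Cuntz isometries identify H with Hⁿ, so that a tuple (Xᵢ) becomes one block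
diagonal operator and (Cᵢ) one isometry V. For an isometry, a unitary dilation followed by averaging
over a diagonal symmetry gives f(V⋆XV) ≤ V⋆f(X)V (`cfc_conj_isometry_le`).

Finite dimension: the convex functions X ↦ ⟨u, f(X)u⟩ satisfy a tangent inequality at diagonal
operators, with the derivative expressed by divided differences (`IsOperatorConvex.tangent_le`).
Testing it on operators with slightly rotated eigenbases shows that the matrices f[cᵢ, cⱼ, x](x −
cᵢ)(x − cⱼ) are positive semidefinite (`secondDiffForm_nonneg`). Summing these forms over the
rank-one pieces of ∑ Cᵢ⋆XᵢCᵢ makes the off-diagonal terms cancel. What remains is Jensen's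
inequality with f on the left replaced by its tangents at the points cᵢ (`sum_tangent_le`). Since f
is convex as a scalar function, it is differentiable off a countable set in the interior, and the cᵢ
can be chosen so that the tangents lose at most ε (`ConvexOn.exists_tangent_ge`). -/

/-! ### Reduction to Jensen's operator inequality -/

section General

variable {H : Type*} [NormedAddCommGroup H] [InnerProductSpace ℂ H] [CompleteSpace H]

/-- Jensen's operator inequality for `f`, with operator coefficients. -/
def OperatorJensen (H : Type*) [NormedAddCommGroup H] [InnerProductSpace ℂ H] [CompleteSpace H]
    (J : Set ℝ) (f : ℝ → ℝ) : Prop :=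
  ∀ (n : ℕ) (X C : Fin n → (H →L[ℂ] H)), (∀ i, X i ∈ spOps H J) →
    ∑ i, star (C i) * C i = 1 →
    cfc f (∑ i, star (C i) * X i * C i) ≤ ∑ i, star (C i) * cfc f (X i) * C i

theorem spectrum_subset_Icc_iff {a b : ℝ} {X : H →L[ℂ] H} (hX : IsSelfAdjoint X) :
    spectrum ℝ X ⊆ Set.Icc a b ↔
      algebraMap ℝ (H →L[ℂ] H) a ≤ X ∧ X ≤ algebraMap ℝ (H →L[ℂ] H) b := by
  rw [algebraMap_le_iff_le_spectrum hX, le_algebraMap_iff_spectrum_le hX]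
  exact ⟨fun h => ⟨fun x hx => (h hx).1, fun x hx => (h hx).2⟩, fun h x hx => ⟨h.1 x hx, h.2 x hx⟩⟩

/-- The union of finitely many spectra is compact and nonempty, so its extreme points lie in J. This
replaces J by a compact interval, where spectral inclusion becomes a pair of operator inequalities.
-/
theorem exists_Icc_of_mem_spOps [Nontrivial H] {J : Set ℝ} {n : ℕ} [NeZero n]
    {X : Fin n → (H →L[ℂ] H)} (hX : ∀ i, X i ∈ spOps H J) :
    ∃ a ∈ J, ∃ b ∈ J, ∀ i, spectrum ℝ (X i) ⊆ Set.Icc a b := by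
  have hc : IsCompact (⋃ i, spectrum ℝ (X i)) :=
    isCompact_iUnion fun i => ContinuousFunctionalCalculus.isCompact_spectrum (R := ℝ) (X i)
  have hne : (⋃ i, spectrum ℝ (X i)).Nonempty := by
    obtain ⟨x, hx⟩ := ContinuousFunctionalCalculus.spectrum_nonempty (R := ℝ) (X 0) (hX 0).1
    exact ⟨x, Set.mem_iUnion.2 ⟨0, hx⟩⟩
  have hsub : (⋃ i, spectrum ℝ (X i)) ⊆ J := Set.iUnion_subset fun i => (hX i).2
  obtain ⟨a, ha⟩ := hc.exists_isLeast hne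
  obtain ⟨b, hb⟩ := hc.exists_isGreatest hne
  exact ⟨a, hsub ha.1, b, hsub hb.1, fun i x hx =>
    ⟨ha.2 (Set.mem_iUnion.2 ⟨i, hx⟩), hb.2 (Set.mem_iUnion.2 ⟨i, hx⟩)⟩⟩

theorem sum_conj_algebraMap {n : ℕ} {C : Fin n → (H →L[ℂ] H)}
    (hC : ∑ i, star (C i) * C i = 1) (a : ℝ) :
    ∑ i, star (C i) * algebraMap ℝ (H →L[ℂ] H) a * C i = algebraMap ℝ (H →L[ℂ] H) a := by
  simp_rw [Algebra.algebraMap_eq_smul_one, mul_smul_comm, smul_mul_assoc, mul_one,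
    ← Finset.smul_sum, hC]

theorem isSelfAdjoint_sum_conj {n : ℕ} {X C : Fin n → (H →L[ℂ] H)}
    (hX : ∀ i, IsSelfAdjoint (X i)) : IsSelfAdjoint (∑ i, star (C i) * X i * C i) :=
  isSelfAdjoint_sum _ fun i _ => (hX i).conjugate' (C i)

/-- `sp(J)` is C⋆-convex. -/
theorem sum_conj_mem_spOps {J : Set ℝ} (hJ : J.OrdConnected) {n : ℕ}
    {X C : Fin n → (H →L[ℂ] H)} (hX : ∀ i, X i ∈ spOps H J)
    (hC : ∑ i, star (C i) * C i = 1) : ∑ i, star (C i) * X i * C i ∈ spOps H J := by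
  refine ⟨isSelfAdjoint_sum_conj fun i => (hX i).1, ?_⟩
  rcases subsingleton_or_nontrivial H with hH | hH
  · rw [spectrum.of_subsingleton]
    exact Set.empty_subset J
  rcases Nat.eq_zero_or_pos n with rfl | hn
  · simp at hC
  have : NeZero n := ⟨hn.ne'⟩
  obtain ⟨a, ha, b, hb, hab⟩ := exists_Icc_of_mem_spOps hX
  refine Set.Subset.trans ?_ (hJ.out ha hb)
  rw [spectrum_subset_Icc_iff (isSelfAdjoint_sum_conj fun i => (hX i).1)]
  have hi := fun i => (spectrum_subset_Icc_iff (hX i).1).1 (hab i)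
  constructor
  · rw [← sum_conj_algebraMap hC a]
    exact Finset.sum_le_sum fun i _ => star_left_conjugate_le_conjugate (hi i).1 (C i)
  · rw [← sum_conj_algebraMap hC b]
    exact Finset.sum_le_sum fun i _ => star_left_conjugate_le_conjugate (hi i).2 (C i)

theorem isOperatorConvex_of_isCStarConvex {J : Set ℝ} {f : ℝ → ℝ}
    (h : IsCStarConvex (H →L[ℂ] H) (operatorEpigraph H J f)) : IsOperatorConvex H J f := by
  rw [isCStarConvex_prod_iff] at h
  intro X hX Y hY
  have hs : ((√2)⁻¹ * (√2)⁻¹ : ℝ) = 1 / 2 := by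
    rw [← mul_inv, Real.mul_self_sqrt (by norm_num)]; norm_num
  have hC : star (((√2)⁻¹ : ℝ) • (1 : H →L[ℂ] H)) = ((√2)⁻¹ : ℝ) • (1 : H →L[ℂ] H) := by simp
  have key : ∀ Z : H →L[ℂ] H, star (((√2)⁻¹ : ℝ) • (1 : H →L[ℂ] H)) * Z *
      (((√2)⁻¹ : ℝ) • (1 : H →L[ℂ] H)) = (1 / 2 : ℝ) • Z := by
    intro Z
    rw [hC, smul_mul_assoc, one_mul, mul_smul_comm, mul_one, smul_smul, hs]
  have := (h 2 ![X, Y] ![cfc f X, cfc f Y] (fun _ => ((√2)⁻¹ : ℝ) • (1 : H →L[ℂ] H)) ?_ ?_).2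
  · simp only [Fin.sum_univ_two, key] at this
    simpa [smul_add] using this
  · intro i
    fin_cases i
    · exact ⟨hX, le_rfl⟩
    · exact ⟨hY, le_rfl⟩
  · have := key 1
    rw [mul_one] at this
    simp only [Fin.sum_univ_two, this, ← add_smul]
    norm_num

theorem isCStarConvex_of_operatorJensen {J : Set ℝ} (hJ : J.OrdConnected) {f : ℝ → ℝ}
    (h : OperatorJensen H J f) : IsCStarConvex (H →L[ℂ] H) (operatorEpigraph H J f) := by
  rw [isCStarConvex_prod_iff]
  intro n X Y C hXY hC
  refine ⟨sum_conj_mem_spOps hJ (fun i => (hXY i).1) hC,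
    (h n X C (fun i => (hXY i).1) hC).trans ?_⟩
  exact Finset.sum_le_sum fun i _ => star_left_conjugate_le_conjugate (hXY i).2 (C i)

end General

/-! ### Cuntz families and block diagonal operators -/

section Cuntz

variable {H : Type*} [NormedAddCommGroup H] [InnerProductSpace ℂ H] [CompleteSpace H]
variable {ι : Type*} [Fintype ι] [DecidableEq ι]

/-- A Cuntz family: isometries on `H` with pairwise orthogonal ranges spanning `H`. -/
structure IsCuntzFamily (S : ι → (H →L[ℂ] H)) : Prop where
  star_mul : ∀ i j, star (S i) * S j = if i = j then 1 else 0
  sum_mul_star : ∑ i, S i * star (S i) = 1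

namespace IsCuntzFamily

variable {S : ι → (H →L[ℂ] H)}

theorem sum_mul_sum (hS : IsCuntzFamily S) (X Y : ι → (H →L[ℂ] H)) :
    (∑ i, S i * X i * star (S i)) * ∑ i, S i * Y i * star (S i) =
      ∑ i, S i * (X i * Y i) * star (S i) := by
  rw [Finset.sum_mul_sum]
  refine Finset.sum_congr rfl fun i _ => ?_
  have : ∀ j, S i * X i * star (S i) * (S j * Y j * star (S j)) =
      S i * X i * (star (S i) * S j) * (Y j * star (S j)) := fun j => by simp only [mul_assoc]
  simp only [this, hS.star_mul]
  simp [mul_assoc]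

/-- The diagonal embedding of `B(H)^ι` into `B(H)` given by a Cuntz family. -/
noncomputable def diag (hS : IsCuntzFamily S) : (ι → (H →L[ℂ] H)) →⋆ₐ[ℂ] (H →L[ℂ] H) where
  toFun X := ∑ i, S i * X i * star (S i)
  map_one' := by simpa using hS.sum_mul_star
  map_mul' X Y := (hS.sum_mul_sum X Y).symm
  map_zero' := by simp
  map_add' X Y := by simp [mul_add, add_mul, Finset.sum_add_distrib]
  commutes' r := by
    simp [Algebra.algebraMap_eq_smul_one, ← Finset.smul_sum, hS.sum_mul_star]
  map_star' X := by simp [star_sum, mul_assoc]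

theorem diag_apply (hS : IsCuntzFamily S) (X : ι → (H →L[ℂ] H)) :
    hS.diag X = ∑ i, S i * X i * star (S i) := rfl

theorem diag_mem_spOps (hS : IsCuntzFamily S) {J : Set ℝ} {X : ι → (H →L[ℂ] H)}
    (hX : ∀ i, X i ∈ spOps H J) : hS.diag X ∈ spOps H J := by
  refine ⟨(show IsSelfAdjoint X from funext fun i => (hX i).1).map hS.diag, ?_⟩
  refine (AlgHom.spectrum_apply_subset (hS.diag.toAlgHom.restrictScalars ℝ) X).trans ?_
  rw [Pi.spectrum_eq]
  exact Set.iUnion_subset fun i => (hX i).2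

/-- A continuous star homomorphism commutes with the functional calculus, which acts coordinatewise
on tuples. -/
theorem cfc_diag (hS : IsCuntzFamily S) {J : Set ℝ} {f : ℝ → ℝ} (hf : ContinuousOn f J)
    {X : ι → (H →L[ℂ] H)} (hX : ∀ i, X i ∈ spOps H J) :
    cfc f (hS.diag X) = hS.diag fun i => cfc f (X i) := by
  have hsa : IsSelfAdjoint X := funext fun i => (hX i).1
  have hsub : (⋃ i, spectrum ℝ (X i)) ⊆ J := Set.iUnion_subset fun i => (hX i).2
  have : ContinuousFunctionalCalculus ℝ (ι → (H →L[ℂ] H)) IsSelfAdjoint :=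
    IsSelfAdjoint.instContinuousFunctionalCalculus
  have hc : Continuous hS.diag := by
    change Continuous fun X : ι → (H →L[ℂ] H) => ∑ i, S i * X i * star (S i)
    fun_prop
  rw [← cfc_map_pi (S := ℂ) f X (hf.mono hsub) hsa fun i => (hX i).1]
  refine (StarAlgHom.map_cfc hS.diag f X ?_ hc hsa (hsa.map hS.diag)).symm
  rw [Pi.spectrum_eq]
  exact hf.mono hsub

end IsCuntzFamily

end Cuntz

/-! ### Jensen's inequality in infinite dimension -/

theorem HilbertBasis.continuousLinearMap_ext {H κ : Type*} [NormedAddCommGroup H]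
    [InnerProductSpace ℂ H] (b : HilbertBasis κ ℂ H)
    {S T : H →L[ℂ] H} (h : ∀ k, S (b k) = T (b k)) : S = T := by
  refine ContinuousLinearMap.ext_on (s := Set.range b) ?_ ?_
  · exact Submodule.dense_iff_topologicalClosure_eq_top.2 b.dense_span
  · rintro _ ⟨k, rfl⟩
    exact h k

theorem HilbertBasis.ext_inner {H κ : Type*} [NormedAddCommGroup H]
    [InnerProductSpace ℂ H] (b : HilbertBasis κ ℂ H) {x y : H}
    (h : ∀ k, inner ℂ (b k) x = inner ℂ (b k) y) : x = y := by
  refine b.repr.injective (lp.ext (funext fun k => ?_))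
  rw [b.repr_apply_apply, b.repr_apply_apply, h k]

section Infinite

variable {H : Type*} [NormedAddCommGroup H] [InnerProductSpace ℂ H] [CompleteSpace H]

theorem HilbertBasis.exists_map_basis {κ : Type*} (b : HilbertBasis κ ℂ H) {v : κ → H}
    (hv : Orthonormal ℂ v) : ∃ S : H →L[ℂ] H, ∀ k, S (b k) = v k := by
  classical
  refine ⟨(hv.orthogonalFamily.linearIsometry.toContinuousLinearMap).comp
    (b.repr.toContinuousLinearEquiv : H →L[ℂ] _), fun k => ?_⟩
  simp [b.repr_self]

/-- An infinite Hilbert basis splits into finitely many parts, each equinumerous with the whole; `S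
i` maps the basis bijectively onto the part of index `i`. -/
theorem exists_isCuntzFamily (hH : ¬ FiniteDimensional ℂ H) (ι : Type) [Fintype ι]
    [DecidableEq ι] [Nonempty ι] : ∃ S : ι → (H →L[ℂ] H), IsCuntzFamily S := by
  classical
  obtain ⟨w, b, -⟩ := exists_hilbertBasis ℂ H
  have hinf : Infinite w := by
    by_contra hfin
    rw [not_infinite_iff_finite] at hfin
    have := Fintype.ofFinite w
    exact hH (b.toOrthonormalBasis.toBasis.finiteDimensional_of_finite)
  obtain ⟨e⟩ : Nonempty (w × ι ≃ w) := by
    rw [← Cardinal.eq, Cardinal.mk_prod, Cardinal.lift_uzero, Cardinal.mul_eq_left]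
    · exact Cardinal.infinite_iff.1 hinf
    · rw [Cardinal.mk_fintype, Cardinal.lift_natCast]
      exact (Cardinal.natCast_lt_aleph0).le.trans (Cardinal.infinite_iff.1 hinf)
    · simp
  have hv : ∀ i : ι, Orthonormal ℂ fun k : w => b (e (k, i)) := fun i =>
    b.orthonormal.comp _ fun k l h => by simpa using h
  choose S hS using fun i => b.exists_map_basis (hv i)
  have hb := orthonormal_iff_ite.1 b.orthonormal
  have hadj : ∀ i j k, star (S i) (b (e (k, j))) = if i = j then b k else 0 := by
    intro i j k
    refine b.ext_inner fun l => ?_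
    rw [ContinuousLinearMap.star_eq_adjoint, ContinuousLinearMap.adjoint_inner_right, hS, hb]
    by_cases h : i = j
    · simp [h, hb]
    · simp [h]
  refine ⟨S, fun i j => b.continuousLinearMap_ext fun k => ?_,
    b.continuousLinearMap_ext fun k => ?_⟩
  · rw [mul_apply_eq_comp, hS, hadj]
    split_ifs <;> simp
  · obtain ⟨⟨l, j⟩, rfl⟩ := e.surjective k
    rw [sum_apply]
    simp only [mul_apply_eq_comp, hadj]
    rw [Finset.sum_eq_single j]
    · simp [hS]
    · intro i _ hij
      simp [hij]
    · simp

theorem conj_mem_spOps {J : Set ℝ} (hJ : J.OrdConnected) {X V : H →L[ℂ] H}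
    (hX : X ∈ spOps H J) (hV : star V * V = 1) : star V * X * V ∈ spOps H J := by
  simpa using sum_conj_mem_spOps hJ (n := 1) (X := fun _ => X) (C := fun _ => V)
    (fun _ => hX) (by simpa using hV)

theorem cfc_conj_unitary {J : Set ℝ} {f : ℝ → ℝ} (hf : ContinuousOn f J) {X U : H →L[ℂ] H}
    (hX : X ∈ spOps H J) (hU : star U * U = 1) (hU' : U * star U = 1) :
    cfc f (star U * X * U) = star U * cfc f X * U := by
  -- A Cuntz family with one member is a unitary.
  have hF : IsCuntzFamily (fun _ : Fin 1 => star U) :=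
    ⟨fun i j => by simp [hU', Subsingleton.elim i j], by simpa using hU⟩
  simpa [hF.diag_apply] using hF.cfc_diag hf (X := fun _ => X) fun _ => hX

/-- Jensen's inequality for a single isometry, by unitary dilation. -/
theorem IsOperatorConvex.cfc_conj_isometry_le (hH : ¬ FiniteDimensional ℂ H) {J : Set ℝ}
    (hJ : J.OrdConnected) {f : ℝ → ℝ} (hf : ContinuousOn f J) (h : IsOperatorConvex H J f)
    {X V : H →L[ℂ] H} (hX : X ∈ spOps H J) (hV : star V * V = 1) :
    cfc f (star V * X * V) ≤ star V * cfc f X * V := by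
  obtain ⟨Z, hZ⟩ := exists_isCuntzFamily hH (Fin 2)
  obtain ⟨S, hSd⟩ : ∃ S, S = Z 0 := ⟨_, rfl⟩
  obtain ⟨T, hTd⟩ : ∃ T, T = Z 1 := ⟨_, rfl⟩
  have hSS : star S * S = 1 := by simpa [hSd] using hZ.star_mul 0 0
  have hTT : star T * T = 1 := by simpa [hTd] using hZ.star_mul 1 1
  have hST : star S * T = 0 := by simpa [hSd, hTd] using hZ.star_mul 0 1
  have hTS : star T * S = 0 := by simpa [hSd, hTd] using hZ.star_mul 1 0
  have hsum : S * star S + T * star T = 1 := by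
    simpa [hSd, hTd, Fin.sum_univ_two] using hZ.sum_mul_star
  have hdiag : ∀ A B : H →L[ℂ] H, hZ.diag ![A, B] = S * A * star S + T * B * star T := by
    intro A B
    simp [hZ.diag_apply, Fin.sum_univ_two, hSd, hTd]
  have hext : ∀ A B : H →L[ℂ] H, A * S = B * S → A * T = B * T → A = B := by
    intro A B h1 h2
    rw [← mul_one A, ← mul_one B, ← hsum, mul_add, mul_add, ← mul_assoc, ← mul_assoc,
      ← mul_assoc, ← mul_assoc, h1, h2]
  obtain ⟨P, hP⟩ : ∃ P, P = 1 - V * star V := ⟨_, rfl⟩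
  have hPs : star P = P := by simp [hP]
  have hPV : P * V = 0 := by rw [hP, sub_mul, mul_assoc, hV]; simp
  have hVP : star V * P = 0 := by rw [hP, mul_sub, ← mul_assoc, hV]; simp
  have hPP : P * P = P := by
    nth_rw 1 [hP]
    rw [sub_mul, mul_assoc, hVP]; simp
  -- With respect to ran S ⊕ ran T this is the block matrix [[V, P], [0, −V⋆]], a unitary with first
  -- column (V, 0).
  obtain ⟨U, hU⟩ : ∃ U, U = S * V * star S + S * P * star T - T * star V * star T := ⟨_, rfl⟩
  have hUS : U * S = S * V := by
    simp [hU, add_mul, sub_mul, mul_assoc, hSS, hTS]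
  have hUT : U * T = S * P - T * star V := by
    simp [hU, add_mul, sub_mul, mul_assoc, hST, hTT]
  have hU' : star U = S * star V * star S + T * P * star S - T * V * star T := by
    simp [hU, mul_assoc, hPs]
  have hUS' : star U * S = S * star V + T * P := by
    simp [hU', add_mul, sub_mul, mul_assoc, hSS, hTS]
  have hUT' : star U * T = -(T * V) := by
    simp [hU', add_mul, sub_mul, mul_assoc, hST, hTT]
  have hUU : star U * U = 1 := by
    refine hext _ _ ?_ ?_
    · rw [mul_assoc, hUS, ← mul_assoc, hUS', add_mul, mul_assoc, mul_assoc, hV, hPV]; simp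
    · rw [mul_assoc, hUT, mul_sub, ← mul_assoc, ← mul_assoc, hUS', hUT', add_mul, mul_assoc,
        mul_assoc, hVP, hPP, hP]; simp [mul_sub, mul_assoc]
  have hUU' : U * star U = 1 := by
    refine hext _ _ ?_ ?_
    · rw [mul_assoc, hUS', mul_add, ← mul_assoc, ← mul_assoc, hUS, hUT, sub_mul, mul_assoc,
        mul_assoc, mul_assoc, hVP, hPP, hP]; simp [mul_sub]
    · rw [mul_assoc, hUT', mul_neg, ← mul_assoc, hUT, sub_mul, mul_assoc, mul_assoc, hPV, hV]
      simp
  -- The symmetry diag(1, −1); averaging an operator with its conjugate by W deletes the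
  -- off-diagonal blocks.
  obtain ⟨W, hW⟩ : ∃ W, W = S * star S - T * star T := ⟨_, rfl⟩
  have hWs : star W = W := by simp [hW]
  have hWS : W * S = S := by simp [hW, sub_mul, mul_assoc, hSS, hTS]
  have hWT : W * T = -T := by simp [hW, sub_mul, mul_assoc, hTT, hST]
  have hWW : W * W = 1 := hext _ _ (by rw [mul_assoc, hWS, hWS, one_mul])
    (by rw [mul_assoc, hWT, mul_neg, hWT, neg_neg, one_mul])
  have hSW : star S * W = star S := by rw [← hWs, ← star_mul, hWS]
  have hTW : star T * W = -star T := by rw [← hWs, ← star_mul, hWT, star_neg]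
  have hXX : ∀ i, (![X, X] : Fin 2 → (H →L[ℂ] H)) i ∈ spOps H J := by
    intro i; fin_cases i <;> exact hX
  have hD := hZ.diag_mem_spOps hXX
  have hX1 := conj_mem_spOps hJ hD hUU
  have hX2 := conj_mem_spOps hJ hX1 (show star W * W = 1 by rw [hWs, hWW])
  have hc1 := cfc_conj_unitary hf hD hUU hUU'
  have hc2 := cfc_conj_unitary hf hX1 (show star W * W = 1 by rw [hWs, hWW])
    (show W * star W = 1 by rw [hWs, hWW])
  obtain ⟨X1, hX1d⟩ : ∃ X1, X1 = star U * hZ.diag ![X, X] * U := ⟨_, rfl⟩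
  rw [← hX1d] at hX1 hX2 hc1 hc2
  have hE : ∀ i, (![star S * X1 * S, star T * X1 * T] : Fin 2 → (H →L[ℂ] H)) i ∈ spOps H J := by
    intro i
    fin_cases i
    · exact conj_mem_spOps hJ hX1 hSS
    · exact conj_mem_spOps hJ hX1 hTT
  have hmid : (1 / 2 : ℝ) • (X1 + star W * X1 * W) =
      hZ.diag ![star S * X1 * S, star T * X1 * T] := by
    have h1 : X1 = (S * star S + T * star T) * X1 * (S * star S + T * star T) := by
      rw [hsum, one_mul, mul_one]
    have h2 : X1 + star W * X1 * W =
        (2 : ℝ) • (S * (star S * X1 * S) * star S + T * (star T * X1 * T) * star T) := by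
      nth_rw 1 [h1]
      rw [hWs, hW, two_smul]
      noncomm_ring
    rw [h2, smul_smul, hdiag]
    norm_num
  have hcomp : ∀ A B : H →L[ℂ] H, star S * hZ.diag ![A, B] * S = A := by
    intro A B
    have h1 : hZ.diag ![A, B] * S = S * A := by
      simp [hdiag, add_mul, mul_assoc, hSS, hTS]
    rw [mul_assoc, h1, ← mul_assoc, hSS, one_mul]
  have hcorner : ∀ A : H →L[ℂ] H,
      star S * (star U * hZ.diag ![A, A] * U) * S = star V * A * V := by
    intro A
    have h1 : star S * (star U * hZ.diag ![A, A] * U) * S =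
        star (U * S) * hZ.diag ![A, A] * (U * S) := by simp only [star_mul, mul_assoc]
    have h2 : star (S * V) * hZ.diag ![A, A] * (S * V) =
        star V * (star S * hZ.diag ![A, A] * S) * V := by simp only [star_mul, mul_assoc]
    rw [h1, hUS, h2, hcomp]
  have hvec : ∀ A B : H →L[ℂ] H,
      (fun i => cfc f ((![A, B] : Fin 2 → (H →L[ℂ] H)) i)) = ![cfc f A, cfc f B] := by
    intro A B
    ext1 i
    fin_cases i <;> rfl
  -- Operator convexity for X1 and its conjugate by W, compressed to the first block.
  have hineq := star_left_conjugate_le_conjugate (h X1 hX1 _ hX2) S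
  rw [hmid, hZ.cfc_diag hf hE, hc2, hc1, hZ.cfc_diag hf hXX, hvec, hvec, hcomp] at hineq
  obtain ⟨Y, hY⟩ : ∃ Y, Y = star U * hZ.diag ![cfc f X, cfc f X] * U := ⟨_, rfl⟩
  have hWY : star S * (star W * Y * W) * S = star S * Y * S := by
    have : star S * (star W * Y * W) * S = (star S * W) * Y * (W * S) := by
      simp only [hWs, mul_assoc]
    rw [this, hSW, hWS]
  have hR : star S * ((1 / 2 : ℝ) • (Y + star W * Y * W)) * S = star V * cfc f X * V := by
    rw [mul_smul_comm, smul_mul_assoc, mul_add, add_mul, hWY, ← two_smul ℝ, smul_smul, hY,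
      hcorner]
    norm_num
  rw [← hY, hR, hX1d, hcorner] at hineq
  exact hineq

theorem IsOperatorConvex.operatorJensen_of_infinite (hH : ¬ FiniteDimensional ℂ H) {J : Set ℝ}
    (hJ : J.OrdConnected) {f : ℝ → ℝ} (hf : ContinuousOn f J) (h : IsOperatorConvex H J f) :
    OperatorJensen H J f := by
  intro n X C hX hC
  have hnt : Nontrivial H := by
    by_contra hn
    rw [not_nontrivial_iff_subsingleton] at hn
    exact hH inferInstance
  rcases Nat.eq_zero_or_pos n with rfl | hn
  · simp at hC
  have : NeZero n := ⟨hn.ne'⟩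
  obtain ⟨S, hS⟩ := exists_isCuntzFamily hH (Fin n)
  -- ∑ Sᵢ Cᵢ plays the role of the column (Cᵢ) from H to Hⁿ, and is an isometry because ∑ Cᵢ⋆Cᵢ = 1.
  have hconj : ∀ Y : Fin n → (H →L[ℂ] H), star (∑ i, S i * C i) * hS.diag Y * (∑ i, S i * C i) =
      ∑ i, star (C i) * Y i * C i := by
    intro Y
    have h1 : hS.diag Y * (∑ i, S i * C i) = ∑ i, S i * (Y i * C i) := by
      rw [hS.diag_apply, Finset.sum_mul_sum]
      refine Finset.sum_congr rfl fun i _ => ?_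
      have : ∀ j, S i * Y i * star (S i) * (S j * C j) =
          S i * Y i * (star (S i) * S j) * C j := fun j => by simp only [mul_assoc]
      simp only [this, hS.star_mul]
      simp [mul_assoc]
    rw [mul_assoc, h1, star_sum, Finset.sum_mul_sum]
    refine Finset.sum_congr rfl fun i _ => ?_
    have : ∀ j, star (S i * C i) * (S j * (Y j * C j)) =
        star (C i) * (star (S i) * S j) * (Y j * C j) := fun j => by
      simp only [star_mul, mul_assoc]
    simp only [this, hS.star_mul]
    simp [mul_assoc]
  have hV : star (∑ i, S i * C i) * (∑ i, S i * C i) = 1 := by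
    have := hconj 1
    rw [map_one, mul_one] at this
    rw [this]
    simpa using hC
  have := h.cfc_conj_isometry_le hH hJ hf (hS.diag_mem_spOps hX) hV
  rwa [hS.cfc_diag hf hX, hconj, hconj] at this

end Infinite

/-! ### Diagonal operators in finite dimension -/

section Diagonal

variable {H : Type*} [NormedAddCommGroup H] [InnerProductSpace ℂ H] [CompleteSpace H]
variable {ι : Type*} [Fintype ι]

namespace OrthonormalBasis

theorem continuousLinearMap_ext {H ι : Type*} [NormedAddCommGroup H] [InnerProductSpace ℂ H]
    [Fintype ι] (b : OrthonormalBasis ι ℂ H)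
    {S T : H →L[ℂ] H} (h : ∀ k, S (b k) = T (b k)) : S = T := by
  apply ContinuousLinearMap.coe_injective
  refine b.toBasis.ext fun k => ?_
  simpa using h k

theorem sum_smul_rankOne_apply {H ι : Type*} [NormedAddCommGroup H] [InnerProductSpace ℂ H]
    [Fintype ι] (b : OrthonormalBasis ι ℂ H) (x : ι → ℂ) (k : ι) :
    (∑ i, x i • InnerProductSpace.rankOne ℂ (b i) (b i)) (b k) = x k • b k := by
  classical
  simp [sum_apply, orthonormal_iff_ite.1 b.orthonormal]

/-- The embedding of `ℂ^ι` as diagonal operators with respect to an orthonormal basis. -/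
noncomputable def diagHom (b : OrthonormalBasis ι ℂ H) : (ι → ℂ) →⋆ₐ[ℂ] (H →L[ℂ] H) where
  toFun x := ∑ i, x i • InnerProductSpace.rankOne ℂ (b i) (b i)
  map_one' := b.continuousLinearMap_ext fun k => by
    rw [b.sum_smul_rankOne_apply]; simp
  map_mul' x y := b.continuousLinearMap_ext fun k => by
    rw [mul_apply_eq_comp, b.sum_smul_rankOne_apply, b.sum_smul_rankOne_apply, map_smul,
      b.sum_smul_rankOne_apply, smul_smul, Pi.mul_apply, mul_comm]
  map_zero' := by simp
  map_add' x y := by simp [add_smul, Finset.sum_add_distrib]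
  commutes' r := b.continuousLinearMap_ext fun k => by
    rw [b.sum_smul_rankOne_apply, Algebra.algebraMap_eq_smul_one]; simp
  map_star' x := by simp [star_sum, ContinuousLinearMap.star_eq_adjoint]

/-- The operator with real eigenvalues `x i` and eigenvectors `b i`. -/
noncomputable def diagOp (b : OrthonormalBasis ι ℂ H) (x : ι → ℝ) : H →L[ℂ] H :=
  b.diagHom fun i => (x i : ℂ)

theorem diagOp_apply (b : OrthonormalBasis ι ℂ H) (x : ι → ℝ) (k : ι) :
    b.diagOp x (b k) = (x k : ℂ) • b k :=
  b.sum_smul_rankOne_apply _ k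

theorem isSelfAdjoint_ofReal {ι : Type*} (x : ι → ℝ) : IsSelfAdjoint fun i => (x i : ℂ) :=
  funext fun i => Complex.conj_ofReal (x i)

theorem spectrum_ofReal (r : ℝ) : spectrum ℝ (r : ℂ) = {r} :=
  spectrum.scalar_eq (A := ℂ) r

theorem isSelfAdjoint_diagOp (b : OrthonormalBasis ι ℂ H) (x : ι → ℝ) :
    IsSelfAdjoint (b.diagOp x) :=
  (isSelfAdjoint_ofReal x).map b.diagHom

theorem spectrum_diagOp_subset (b : OrthonormalBasis ι ℂ H) (x : ι → ℝ) :
    spectrum ℝ (b.diagOp x) ⊆ Set.range x := by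
  refine (AlgHom.spectrum_apply_subset (b.diagHom.toAlgHom.restrictScalars ℝ) _).trans ?_
  rw [Pi.spectrum_eq]
  refine Set.iUnion_subset fun i => ?_
  rw [spectrum_ofReal]
  rintro _ rfl
  exact ⟨i, rfl⟩

theorem diagOp_mem_spOps (b : OrthonormalBasis ι ℂ H) {J : Set ℝ} {x : ι → ℝ}
    (hx : ∀ i, x i ∈ J) : b.diagOp x ∈ spOps H J :=
  ⟨b.isSelfAdjoint_diagOp x, (b.spectrum_diagOp_subset x).trans (Set.range_subset_iff.2 hx)⟩

theorem cfc_diagOp (b : OrthonormalBasis ι ℂ H) (f : ℝ → ℝ) (x : ι → ℝ) :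
    cfc f (b.diagOp x) = b.diagOp fun i => f (x i) := by
  have hsa := isSelfAdjoint_ofReal x
  -- The spectrum is finite, so every function is continuous on it.
  have hfin : (⋃ i, spectrum ℝ ((fun i => (x i : ℂ)) i)).Finite :=
    Set.finite_iUnion fun i => by rw [spectrum_ofReal]; exact Set.finite_singleton _
  have hcont : ContinuousOn f (⋃ i, spectrum ℝ ((fun i => (x i : ℂ)) i)) := hfin.continuousOn f
  have : ContinuousFunctionalCalculus ℝ (ι → ℂ) IsSelfAdjoint :=
    IsSelfAdjoint.instContinuousFunctionalCalculus
  have hc : Continuous b.diagHom := by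
    change Continuous fun y : ι → ℂ => ∑ i, y i • InnerProductSpace.rankOne ℂ (b i) (b i)
    fun_prop
  have h1 := cfc_map_pi (S := ℂ) f (fun i => (x i : ℂ)) hcont hsa
    fun i => Complex.conj_ofReal (x i)
  have h2 := StarAlgHom.map_cfc b.diagHom f (fun i => (x i : ℂ))
    (by rw [Pi.spectrum_eq]; exact hcont) hc hsa (hsa.map b.diagHom)
  rw [diagOp, ← h2, h1, diagOp]
  congr 1
  ext1 i
  exact cfc_algebraMap (A := ℂ) (p := IsSelfAdjoint) (x i) f

theorem mem_spectrum_of_apply_eq {H : Type*} [NormedAddCommGroup H] [InnerProductSpace ℂ H]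
    {X : H →L[ℂ] H} {r : ℝ} {v : H} (hv : v ≠ 0)
    (h : X v = (r : ℂ) • v) : r ∈ spectrum ℝ X := by
  rw [spectrum.mem_iff]
  intro hu
  obtain ⟨u, hu⟩ := hu
  apply hv
  have h1 : (u⁻¹.val * u.val) v = v := by rw [Units.inv_mul]; rfl
  rw [← h1, mul_apply_eq_comp, hu]
  have : (algebraMap ℝ (H →L[ℂ] H) r - X) v = 0 := by
    rw [Algebra.algebraMap_eq_smul_one]
    simp [h]
  rw [this, map_zero]

end OrthonormalBasis

open OrthonormalBasis in
theorem exists_eq_diagOp [FiniteDimensional ℂ H] {J : Set ℝ} {X : H →L[ℂ] H}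
    (hX : X ∈ spOps H J) :
    ∃ (b : OrthonormalBasis (Fin (Module.finrank ℂ H)) ℂ H) (x : _ → ℝ),
      X = b.diagOp x ∧ ∀ i, x i ∈ J := by
  have hs : (X : H →ₗ[ℂ] H).IsSymmetric :=
    ContinuousLinearMap.isSelfAdjoint_iff_isSymmetric.1 hX.1
  have hb : ∀ i, X (hs.eigenvectorBasis rfl i) =
      ((hs.eigenvalues rfl i : ℝ) : ℂ) • hs.eigenvectorBasis rfl i := fun i =>
    hs.apply_eigenvectorBasis rfl i
  refine ⟨hs.eigenvectorBasis rfl, hs.eigenvalues rfl, ?_, fun i => hX.2 ?_⟩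
  · exact continuousLinearMap_ext _ fun k => by rw [hb, diagOp_apply]
  · refine mem_spectrum_of_apply_eq ?_ (hb i)
    exact (hs.eigenvectorBasis rfl).orthonormal.ne_zero i

end Diagonal

/-! ### Scalar convex functions and their tangents -/

section ConvexReal

open Set Filter Topology

theorem convexOn_of_midpoint {J : Set ℝ} (hJ : J.OrdConnected) {f : ℝ → ℝ}
    (hf : ContinuousOn f J)
    (hmid : ∀ x ∈ J, ∀ y ∈ J, f ((x + y) / 2) ≤ (f x + f y) / 2) : ConvexOn ℝ J f := by
  refine LinearOrder.convexOn_of_lt hJ.convex fun x hx y hy hxy a b ha hb hab => ?_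
  have hIcc : Icc x y ⊆ J := hJ.out hx hy
  obtain ⟨m, hm⟩ : ∃ m, m = (f y - f x) / (y - x) := ⟨_, rfl⟩
  have hm' : m * (y - x) = f y - f x := by
    rw [hm]; exact div_mul_cancel₀ _ (sub_pos.2 hxy).ne'
  -- The function minus its chord over [x, y]; convexity amounts to g ≤ 0 there.
  let g : ℝ → ℝ := fun t => f t - f x - m * (t - x)
  have hgc : ContinuousOn g (Icc x y) :=
    ((hf.mono hIcc).sub continuousOn_const).sub (by fun_prop)
  have hgm : ∀ s ∈ Icc x y, ∀ t ∈ Icc x y, g ((s + t) / 2) ≤ (g s + g t) / 2 := by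
    intro s hs t ht
    have := hmid s (hIcc hs) t (hIcc ht)
    simp only [g]
    linarith
  have hg0 : ∀ t ∈ Icc x y, g t ≤ 0 := by
    by_contra! hcon
    obtain ⟨t0, ht0, hpos⟩ := hcon
    obtain ⟨c0, hc0, hmax⟩ := isCompact_Icc.exists_isMaxOn ⟨t0, ht0⟩ hgc
    have hM : 0 < g c0 := hpos.trans_le (hmax ht0)
    have hcl : IsCompact (Icc x y ∩ g ⁻¹' {g c0}) :=
      isCompact_Icc.of_isClosed_subset (hgc.preimage_isClosed_of_isClosed isClosed_Icc
        isClosed_singleton) inter_subset_left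
    -- At the leftmost maximiser c, the value at c − d is strictly below the maximum, which
    -- contradicts midpoint convexity at c ± d.
    obtain ⟨c, ⟨hc, hgc0⟩, hleast⟩ := hcl.exists_isLeast ⟨c0, hc0, rfl⟩
    have hgc0 : g c = g c0 := hgc0
    have hgx : g x = 0 := by simp [g]
    have hgy : g y = 0 := by simp only [g]; linarith
    have hxc : x < c := lt_of_le_of_ne hc.1 fun h => by rw [← h, hgx] at hgc0; linarith
    have hcy : c < y := lt_of_le_of_ne hc.2 fun h => by rw [h, hgy] at hgc0; linarith
    obtain ⟨d, hd0, hd1, hd2⟩ : ∃ d, 0 < d ∧ d ≤ c - x ∧ d ≤ y - c :=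
      ⟨min (c - x) (y - c), lt_min (by linarith) (by linarith), min_le_left _ _, min_le_right _ _⟩
    have hl : c - d ∈ Icc x y := ⟨by linarith, by linarith⟩
    have hr : c + d ∈ Icc x y := ⟨by linarith, by linarith⟩
    have h1 := hgm _ hl _ hr
    rw [show (c - d + (c + d)) / 2 = c by ring, hgc0] at h1
    have h2 : g (c + d) ≤ g c0 := hmax hr
    have h3 : g (c - d) < g c0 := lt_of_le_of_ne (hmax hl) fun h => by
      have := hleast ⟨hl, h⟩
      linarith
    linarith
  have hz : a • x + b • y ∈ Icc x y := by
    have := (convex_Icc x y) (left_mem_Icc.2 hxy.le) (right_mem_Icc.2 hxy.le) ha.le hb.le hab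
    exact this
  have := hg0 _ hz
  simp only [g, smul_eq_mul] at this ⊢
  have ha' : a = 1 - b := by linarith
  subst ha'
  have : f ((1 - b) * x + b * y) - f x - b * (m * (y - x)) ≤ 0 := by
    convert this using 2; ring
  rw [hm'] at this
  linarith

theorem ConvexOn.tangent_le {S : Set ℝ} {f : ℝ → ℝ} (hf : ConvexOn ℝ S f) {c y : ℝ} (hc : c ∈ S)
    (hy : y ∈ S) (hd : DifferentiableAt ℝ f c) : f c + deriv f c * (y - c) ≤ f y := by
  rcases lt_trichotomy c y with h | rfl | h
  · have := hf.le_slope_of_hasDerivAt hc hy h hd.hasDerivAt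
    rw [slope_def_field, le_div_iff₀ (by linarith)] at this
    linarith
  · simp
  · have := hf.slope_le_of_hasDerivAt hy hc h hd.hasDerivAt
    rw [slope_def_field, div_le_iff₀ (by linarith)] at this
    linarith

/-- The right derivative is monotone, hence continuous off a countable set. For y < x it is at most
the left derivative at x, so at a continuity point y → x makes the one-sided derivatives agree. -/
theorem ConvexOn.countable_not_differentiableAt {S : Set ℝ} {f : ℝ → ℝ} (hf : ConvexOn ℝ S f) :
    {x | x ∈ interior S ∧ ¬ DifferentiableAt ℝ f x}.Countable := by
  refine hf.monotoneOn_rightDeriv.countable_not_continuousWithinAt.mono ?_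
  rintro x ⟨hx, hd⟩
  refine ⟨hx, fun hcont => hd ?_⟩
  have hle : derivWithin f (Ioi x) x ≤ derivWithin f (Iio x) x := by
    have hnhds : interior S ∈ 𝓝 x := isOpen_interior.mem_nhds hx
    have ht : Tendsto (fun y => derivWithin f (Ioi y) y) (𝓝[<] x)
        (𝓝 (derivWithin f (Ioi x) x)) :=
      (hcont.continuousAt hnhds).tendsto.mono_left nhdsWithin_le_nhds
    refine le_of_tendsto ht ?_
    filter_upwards [self_mem_nhdsWithin, nhdsWithin_le_nhds hnhds] with y hyx hy
    exact (hf.rightDeriv_le_slope_of_mem_interior hy (interior_subset hx) hyx).trans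
      (hf.slope_le_leftDeriv_of_mem_interior (interior_subset hy) hx hyx)
  have heq := le_antisymm (hf.leftDeriv_le_rightDeriv_of_mem_interior hx) hle
  have hr := hf.hasDerivWithinAt_rightDeriv_of_mem_interior hx
  have hl := hf.hasDerivWithinAt_leftDeriv_of_mem_interior hx
  rw [heq] at hl
  exact (hasDerivAt_iff_tendsto_slope_left_right.2
    ⟨(hasDerivWithinAt_iff_tendsto_slope' self_notMem_Iio).1 hl,
      (hasDerivWithinAt_iff_tendsto_slope' self_notMem_Ioi).1 hr⟩).differentiableAt

/-- A continuous convex function is the supremum of its tangents at interior points of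
differentiability. -/
theorem ConvexOn.exists_tangent_ge {S : Set ℝ} {f : ℝ → ℝ} (hf : ConvexOn ℝ S f)
    (hcont : ContinuousOn f S) (hS : (interior S).Nonempty) {a : ℝ} (ha : a ∈ S) {ε : ℝ}
    (hε : 0 < ε) : ∃ c ∈ interior S, DifferentiableAt ℝ f c ∧
      f a - ε ≤ f c + deriv f c * (a - c) := by
  obtain ⟨y, hy, hya⟩ : ∃ y ∈ interior S, y ≠ a := by
    obtain ⟨z, hz⟩ := hS
    obtain ⟨y, hy, hya⟩ := ((infinite_of_mem_nhds z (isOpen_interior.mem_nhds hz)).sdiff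
      (finite_singleton a)).nonempty
    exact ⟨y, hy, hya⟩
  let c : ℝ → ℝ := fun θ => (1 - θ) * a + θ * y
  have hc : ∀ θ ∈ Ioo (0 : ℝ) 1, c θ ∈ interior S := fun θ hθ =>
    hf.1.combo_self_interior_mem_interior ha hy (by linarith [hθ.2]) hθ.1 (by ring)
  have hcc : Continuous c := by fun_prop
  have hc0 : c 0 = a := by simp [c]
  have hev : ∀ᶠ θ in 𝓝[>] (0 : ℝ), θ ∈ Ioo (0 : ℝ) 1 := Ioo_mem_nhdsGT one_pos
  have hfc : Tendsto (fun θ => f (c θ)) (𝓝[>] 0) (𝓝 (f a)) := by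
    have h1 : Tendsto c (𝓝[>] 0) (𝓝[S] a) := by
      refine tendsto_nhdsWithin_iff.2 ⟨?_, ?_⟩
      · rw [← hc0]; exact (hcc.tendsto 0).mono_left nhdsWithin_le_nhds
      · filter_upwards [hev] with θ hθ using interior_subset (hc θ hθ)
    exact (hcont a ha).tendsto.comp h1
  have hlim : Tendsto (fun θ => f (c θ) - θ / (1 - θ) * (f y - f (c θ))) (𝓝[>] 0)
      (𝓝 (f a - 0 / (1 - 0) * (f y - f a))) := by
    have h1 : Tendsto (fun θ : ℝ => θ) (𝓝[>] 0) (𝓝 0) := nhdsWithin_le_nhds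
    exact hfc.sub ((h1.div (tendsto_const_nhds.sub h1) (by norm_num)).mul
      (tendsto_const_nhds.sub hfc))
  have hev2 := hlim.eventually (lt_mem_nhds (show f a - ε < f a - 0 / (1 - 0) * (f y - f a) by
    simpa using hε))
  obtain ⟨η, hη, hsub⟩ := (mem_nhdsGT_iff_exists_Ioo_subset).1 (hev.and hev2)
  have hN : {θ | c θ ∈ {x | x ∈ interior S ∧ ¬ DifferentiableAt ℝ f x}}.Countable := by
    refine hf.countable_not_differentiableAt.preimage_of_injOn fun s _ t _ hst => ?_
    have h1 : (s - t) * (y - a) = 0 := by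
      simp only [c] at hst
      linarith
    rcases mul_eq_zero.1 h1 with h | h
    · linarith
    · exact absurd (by linarith) hya
  -- The exceptional θ are countable, so arbitrarily small good ones exist.
  obtain ⟨θ, hθN, hθ⟩ := (hN.dense_compl ℝ).exists_between hη
  obtain ⟨h01, hlt⟩ := hsub hθ
  have hint := hc θ h01
  have hdiff : DifferentiableAt ℝ f (c θ) := by
    by_contra h
    exact hθN ⟨hint, h⟩
  refine ⟨c θ, hint, hdiff, hlt.le.trans ?_⟩
  have htan := hf.tangent_le (interior_subset hint) (interior_subset hy) hdiff
  have h1 : 0 < 1 - θ := by linarith [h01.2]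
  -- The points a and y lie on opposite sides of c θ. The tangent inequality at y therefore bounds
  -- the tangent at a from below, with no bound on the derivative needed.
  have h2 : deriv f (c θ) * (a - c θ) = -(θ / (1 - θ)) * (deriv f (c θ) * (y - c θ)) := by
    simp only [c]
    field_simp
    ring
  have h3 : 0 ≤ θ / (1 - θ) := (div_pos h01.1 h1).le
  rw [h2]
  nlinarith

end ConvexReal

/-! ### Tangent inequality for X ↦ ⟨u, f(X)u⟩ -/

section FirstVariation

open Set Filter Topology

theorem ContinuousLinearMap.re_inner_le_of_le {H : Type*} [NormedAddCommGroup H]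
    [InnerProductSpace ℂ H] {A B : H →L[ℂ] H} (h : A ≤ B) (u : H) :
    (inner ℂ u (A u)).re ≤ (inner ℂ u (B u)).re := by
  have := ((ContinuousLinearMap.le_def A B).1 h).re_inner_nonneg_right u
  simpa [inner_sub_right] using this

variable {H : Type*} [NormedAddCommGroup H] [InnerProductSpace ℂ H] [CompleteSpace H]

theorem ContinuousLinearMap.le_of_re_inner_le {A B : H →L[ℂ] H} (hA : IsSelfAdjoint A)
    (hB : IsSelfAdjoint B) (h : ∀ u, (inner ℂ u (A u)).re ≤ (inner ℂ u (B u)).re) : A ≤ B := by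
  rw [ContinuousLinearMap.le_def, ContinuousLinearMap.isPositive_def]
  refine ⟨ContinuousLinearMap.isSelfAdjoint_iff_isSymmetric.1 (hB.sub hA), fun u => ?_⟩
  rw [ContinuousLinearMap.reApplyInnerSelf_apply, inner_re_symm]
  simpa [inner_sub_right] using h u

theorem add_smul_sub_mem_spOps_Icc {α β : ℝ} {A B : H →L[ℂ] H} (hA : A ∈ spOps H (Icc α β))
    (hB : B ∈ spOps H (Icc α β)) {t : ℝ} (ht0 : 0 ≤ t) (ht1 : t ≤ 1) :
    A + t • (B - A) ∈ spOps H (Icc α β) := by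
  have hsa : IsSelfAdjoint (A + t • (B - A)) :=
    hA.1.add (IsSelfAdjoint.smul (IsSelfAdjoint.all t) (hB.1.sub hA.1))
  refine ⟨hsa, (spectrum_subset_Icc_iff hsa).2 ?_⟩
  have h := (convex_Icc (algebraMap ℝ (H →L[ℂ] H) α) (algebraMap ℝ (H →L[ℂ] H) β))
    ((spectrum_subset_Icc_iff hA.1).1 hA.2) ((spectrum_subset_Icc_iff hB.1).1 hB.2)
    (sub_nonneg.2 ht1) ht0 (by ring)
  have e : (1 - t) • A + t • B = A + t • (B - A) := by module
  rw [e] at h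
  exact h

/-- The identity f(y) = f(c) + f[c, y](y − c) under the functional calculus. It needs
differentiability at c only, and replaces a derivative of the functional calculus. -/
theorem cfc_eq_add_dslope_mul {J : Set ℝ} {f : ℝ → ℝ} (hf : ContinuousOn f J) {c : ℝ}
    (hc : c ∈ interior J) (hd : DifferentiableAt ℝ f c) {Z : H →L[ℂ] H} (hZ : Z ∈ spOps H J) :
    cfc f Z = algebraMap ℝ (H →L[ℂ] H) (f c) +
      cfc (dslope f c) Z * (Z - algebraMap ℝ (H →L[ℂ] H) c) := by
  have hr : ContinuousOn (dslope f c) (spectrum ℝ Z) :=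
    ((continuousOn_dslope (mem_interior_iff_mem_nhds.1 hc)).2 ⟨hf, hd⟩).mono hZ.2
  have h1 : cfc (fun y : ℝ => y - c) Z = Z - algebraMap ℝ (H →L[ℂ] H) c := by
    rw [cfc_sub (fun y : ℝ => y) (fun _ => c) Z, cfc_id' ℝ Z hZ.1, cfc_const c Z hZ.1]
  rw [← h1, ← cfc_mul (dslope f c) (fun y : ℝ => y - c) Z hr,
    ← cfc_const (f c) Z hZ.1, ← cfc_add Z (fun _ => f c) (fun y => dslope f c y * (y - c))
      continuousOn_const (hr.mul (by fun_prop))]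
  refine cfc_congr fun y _ => ?_
  have := sub_smul_dslope f c y
  rw [smul_eq_mul] at this
  linarith

/-- Operator convexity along the segment from `A` to `B`, in quadratic form. -/
theorem IsOperatorConvex.re_inner_cfc_dyadic_le {J : Set ℝ} {f : ℝ → ℝ}
    (h : IsOperatorConvex H J f) {α β : ℝ} (hαβ : Icc α β ⊆ J) {A B : H →L[ℂ] H}
    (hA : A ∈ spOps H (Icc α β)) (hB : B ∈ spOps H (Icc α β)) (u : H) (m : ℕ) :
    (inner ℂ u (cfc f (A + ((1 / 2 : ℝ) ^ m) • (B - A)) u)).re ≤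
      (inner ℂ u (cfc f A u)).re +
        (1 / 2 : ℝ) ^ m * ((inner ℂ u (cfc f B u)).re - (inner ℂ u (cfc f A u)).re) := by
  have hmono : ∀ {X : H →L[ℂ] H}, X ∈ spOps H (Icc α β) → X ∈ spOps H J :=
    fun hX => ⟨hX.1, hX.2.trans hαβ⟩
  induction m with
  | zero => simp
  | succ m ih =>
    have hZ := add_smul_sub_mem_spOps_Icc hA hB (t := (1 / 2 : ℝ) ^ m) (by positivity)
      (pow_le_one₀ (by norm_num) (by norm_num))
    have e : A + ((1 / 2 : ℝ) ^ (m + 1)) • (B - A) =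
        (1 / 2 : ℝ) • (A + (A + ((1 / 2 : ℝ) ^ m) • (B - A))) := by
      rw [pow_succ]; module
    have h1 := ContinuousLinearMap.re_inner_le_of_le (h A (hmono hA) _ (hmono hZ)) u
    rw [← e] at h1
    have h2 : (inner ℂ u (((1 / 2 : ℝ) • (cfc f A + cfc f (A + ((1 / 2 : ℝ) ^ m) • (B - A)))) u)).re
        = 1 / 2 * ((inner ℂ u (cfc f A u)).re +
          (inner ℂ u (cfc f (A + ((1 / 2 : ℝ) ^ m) • (B - A)) u)).re) := by
      rw [smul_apply, add_apply, ← Complex.coe_smul, inner_smul_right,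
        Complex.re_ofReal_mul, inner_add_right, Complex.add_re]
    refine (h1.trans_eq h2).trans ?_
    rw [pow_succ]
    linarith

variable {ι : Type*} [Fintype ι]

theorem OrthonormalBasis.inner_diagOp (b : OrthonormalBasis ι ℂ H) (x : ι → ℝ) (y z : H) :
    inner ℂ y (b.diagOp x z) = ∑ k, (x k : ℂ) * (inner ℂ y (b k) * inner ℂ (b k) z) := by
  change inner ℂ y ((∑ i, (x i : ℂ) • InnerProductSpace.rankOne ℂ (b i) (b i)) z) = _
  rw [sum_apply, inner_sum]
  refine Finset.sum_congr rfl fun k _ => ?_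
  rw [smul_apply, InnerProductSpace.rankOne_apply, inner_smul_right,
    inner_smul_right]
  ring

/-- The tangent inequality for the convex function `X ↦ ⟨u, f(X) u⟩` at a diagonal operator,
with the derivative written out in terms of divided differences. -/
theorem IsOperatorConvex.tangent_le [Nontrivial H] {J : Set ℝ} (hJ : J.OrdConnected) {f : ℝ → ℝ}
    (hf : ContinuousOn f J) (h : IsOperatorConvex H J f) (b : OrthonormalBasis ι ℂ H)
    {a : ι → ℝ} (ha : ∀ i, a i ∈ interior J) (hd : ∀ i, DifferentiableAt ℝ f (a i))
    {B : H →L[ℂ] H} (hB : B ∈ spOps H J) (v : ι → ℝ) :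
    ∑ i, f (a i) * v i ^ 2 + ∑ i, ∑ j, v i * v j * dslope f (a i) (a j) *
        (inner ℂ (b j) ((B - b.diagOp a) (b i))).re ≤
      (inner ℂ (∑ i, (v i : ℂ) • b i) (cfc f B (∑ i, (v i : ℂ) • b i))).re := by
  classical
  obtain ⟨u, hu⟩ : ∃ u, u = ∑ i, (v i : ℂ) • b i := ⟨_, rfl⟩
  obtain ⟨A, hAd⟩ : ∃ A, A = b.diagOp a := ⟨_, rfl⟩
  have hAJ : A ∈ spOps H J := hAd ▸ b.diagOp_mem_spOps fun i => interior_subset (ha i)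
  obtain ⟨α, hα, β, hβ, hAB⟩ := exists_Icc_of_mem_spOps (X := ![A, B]) (J := J) (by
    intro i; fin_cases i
    · exact hAJ
    · exact hB)
  have hA' : A ∈ spOps H (Icc α β) := ⟨hAJ.1, hAB 0⟩
  have hB' : B ∈ spOps H (Icc α β) := ⟨hB.1, hAB 1⟩
  have hK : Icc α β ⊆ J := hJ.out hα hβ
  let Z : ℕ → (H →L[ℂ] H) := fun m => A + ((1 / 2 : ℝ) ^ m) • (B - A)
  have hZ : ∀ m, Z m ∈ spOps H (Icc α β) := fun m =>
    add_smul_sub_mem_spOps_Icc hA' hB' (by positivity) (pow_le_one₀ (by norm_num) (by norm_num))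
  have hZA : Tendsto Z atTop (𝓝 A) := by
    have h1 : Tendsto (fun m : ℕ => (1 / 2 : ℝ) ^ m) atTop (𝓝 0) :=
      tendsto_pow_atTop_nhds_zero_of_lt_one (by norm_num) (by norm_num)
    have h2 := (tendsto_const_nhds (x := A)).add (h1.smul_const (B - A))
    rwa [zero_smul, add_zero] at h2
  have hbu : ∀ i, inner ℂ u (b i) = (v i : ℂ) := by
    intro i
    rw [hu, sum_inner]
    simp_rw [inner_smul_left, orthonormal_iff_ite.1 b.orthonormal, Complex.conj_ofReal]
    simp
  have hcol : ∀ m i, cfc f (Z m) (b i) = (f (a i) : ℂ) • b i +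
      (((1 / 2 : ℝ) ^ m : ℝ) : ℂ) • cfc (dslope f (a i)) (Z m) ((B - A) (b i)) := by
    intro m i
    -- Since `b i` is an eigenvector of A for `a i`, only the perturbation survives, and the factor
    -- 2⁻ᵐ comes out exactly.
    have hZb : (Z m - algebraMap ℝ (H →L[ℂ] H) (a i)) (b i) =
        (((1 / 2 : ℝ) ^ m : ℝ) : ℂ) • (B - A) (b i) := by
      have h1 : A (b i) = (a i : ℂ) • b i := by rw [hAd, b.diagOp_apply]
      simp only [Z, Algebra.algebraMap_eq_smul_one, sub_apply, add_apply,
        smul_apply, h1, one_apply_eq_self, Complex.coe_smul]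
      abel
    rw [cfc_eq_add_dslope_mul hf (ha i) (hd i) ⟨(hZ m).1, (hZ m).2.trans hK⟩, add_apply,
      mul_apply_eq_comp, hZb, map_smul, Algebra.algebraMap_eq_smul_one]
    simp
  have hquad : ∀ m, (inner ℂ u (cfc f (Z m) u)).re = ∑ i, f (a i) * v i ^ 2 +
      (1 / 2 : ℝ) ^ m *
        ∑ i, v i * (inner ℂ u (cfc (dslope f (a i)) (Z m) ((B - A) (b i)))).re := by
    intro m
    nth_rw 2 [hu]
    rw [map_sum, inner_sum, Complex.re_sum, Finset.mul_sum, ← Finset.sum_add_distrib]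
    refine Finset.sum_congr rfl fun i _ => ?_
    rw [map_smul, hcol, inner_smul_right, inner_add_right, inner_smul_right, inner_smul_right,
      hbu, Complex.re_ofReal_mul, Complex.add_re, Complex.re_ofReal_mul, Complex.re_ofReal_mul,
      Complex.ofReal_re]
    ring
  have hquadA : (inner ℂ u (cfc f A u)).re = ∑ i, f (a i) * v i ^ 2 := by
    rw [hAd, b.cfc_diagOp, b.inner_diagOp, Complex.re_sum]
    refine Finset.sum_congr rfl fun i _ => ?_
    rw [hbu, ← inner_conj_symm, hbu, Complex.re_ofReal_mul, Complex.conj_ofReal,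
      ← Complex.ofReal_mul, Complex.ofReal_re]
    ring
  have hle : ∀ m, ∑ i, v i * (inner ℂ u (cfc (dslope f (a i)) (Z m) ((B - A) (b i)))).re ≤
      (inner ℂ u (cfc f B u)).re - ∑ i, f (a i) * v i ^ 2 := by
    intro m
    have h1 := h.re_inner_cfc_dyadic_le hK hA' hB' u m
    rw [show A + ((1 / 2 : ℝ) ^ m) • (B - A) = Z m from rfl, hquad, hquadA] at h1
    exact le_of_mul_le_mul_left (by linarith) (show (0 : ℝ) < (1 / 2) ^ m by positivity)
  have hlim : Tendsto
      (fun m => ∑ i, v i * (inner ℂ u (cfc (dslope f (a i)) (Z m) ((B - A) (b i)))).re) atTop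
      (𝓝 (∑ i, v i * (inner ℂ u (cfc (dslope f (a i)) A ((B - A) (b i)))).re)) := by
    refine tendsto_finsetSum _ fun i _ => Tendsto.const_mul _ ?_
    have h1 : Tendsto (fun m => cfc (dslope f (a i)) (Z m)) atTop
        (𝓝 (cfc (dslope f (a i)) A)) :=
      Filter.Tendsto.cfc isCompact_Icc (dslope f (a i)) hZA
        (Eventually.of_forall fun m => (hZ m).2) (Eventually.of_forall fun m => (hZ m).1)
        hA'.2 hA'.1
        (((continuousOn_dslope (mem_interior_iff_mem_nhds.1 (ha i))).2 ⟨hf, hd i⟩).mono hK)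
    have h2 : Continuous fun T : H →L[ℂ] H => (inner ℂ u (T ((B - A) (b i)))).re := by fun_prop
    exact (h2.tendsto _).comp h1
  have hfin := le_of_tendsto' hlim hle
  have hval : ∀ i, (inner ℂ u (cfc (dslope f (a i)) A ((B - A) (b i)))).re =
      ∑ j, v j * dslope f (a i) (a j) * (inner ℂ (b j) ((B - A) (b i))).re := by
    intro i
    rw [hAd, b.cfc_diagOp, b.inner_diagOp, Complex.re_sum]
    refine Finset.sum_congr rfl fun j _ => ?_
    rw [hbu, Complex.re_ofReal_mul, Complex.re_ofReal_mul]
    ring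
  rw [← hu, ← hAd]
  simp only [hval, Finset.mul_sum] at hfin
  have e : ∑ i, ∑ j, v i * v j * dslope f (a i) (a j) * (inner ℂ (b j) ((B - A) (b i))).re =
      ∑ i, ∑ j, v i * (v j * dslope f (a i) (a j) * (inner ℂ (b j) ((B - A) (b i))).re) := by
    simp only [mul_assoc]
  rw [e]
  linarith

end FirstVariation

/-! ### The kernel of second divided differences -/

section SecondDifference

open Set Filter Topology

variable {ι : Type*}

/-- The kernel `f[c i, c j, x] (x - c i) (x - c j)` of second divided differences, written without
division by `(x - c i) (x - c j)`. -/
noncomputable def secondDiff (f : ℝ → ℝ) (c : ι → ℝ) (x : ℝ) (i j : ι) : ℝ :=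
  f x - f (c i) - (x - c i) * dslope f (c i) (c j)

theorem secondDiff_left (f : ℝ → ℝ) (c : ι → ℝ) (k j : ι) : secondDiff f c (c k) k j = 0 := by
  simp [secondDiff]

theorem secondDiff_right (f : ℝ → ℝ) (c : ι → ℝ) (k i : ι) : secondDiff f c (c k) i k = 0 := by
  have := sub_smul_dslope f (c i) (c k)
  rw [smul_eq_mul] at this
  simp only [secondDiff]
  linarith

variable [Fintype ι]

/-- The quadratic form of `secondDiff`. -/
noncomputable def secondDiffForm (f : ℝ → ℝ) (c : ι → ℝ) (x : ℝ) (η : ι → ℝ) : ℝ :=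
  ∑ i, ∑ j, η i * η j * secondDiff f c x i j

/-- At x = c k, row k and column k of the kernel vanish, so the form ignores coordinate k. -/
theorem secondDiffForm_add_single [DecidableEq ι] (f : ℝ → ℝ) (c : ι → ℝ) (k : ι) (r : ℝ)
    (η : ι → ℝ) : secondDiffForm f c (c k) (fun i => (if i = k then r else 0) + η i) =
      secondDiffForm f c (c k) η := by
  refine Finset.sum_congr rfl fun i _ => Finset.sum_congr rfl fun j _ => ?_
  by_cases hi : i = k
  · rw [hi, secondDiff_left]; simp
  by_cases hj : j = k
  · rw [hj, secondDiff_right]; simp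
  simp [hi, hj]

theorem secondDiffForm_smul (f : ℝ → ℝ) (c : ι → ℝ) (x r : ℝ) (η : ι → ℝ) :
    secondDiffForm f c x (fun i => r * η i) = r ^ 2 * secondDiffForm f c x η := by
  simp only [secondDiffForm, Finset.mul_sum]
  refine Finset.sum_congr rfl fun i _ => Finset.sum_congr rfl fun j _ => ?_
  ring

/-- The kernel is affine in (f(x), x), so beyond the f(x k) terms only the moments ∑ M k and ∑ x k ·
M k enter. -/
theorem sum_mul_secondDiff {κ : Type*} [Fintype κ] (f : ℝ → ℝ) (c : ι → ℝ) (x : κ → ℝ)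
    (M : κ → ι → ι → ℝ) :
    ∑ k, ∑ i, ∑ j, M k i j * secondDiff f c (x k) i j =
      ∑ k, f (x k) * ∑ i, ∑ j, M k i j
        - ∑ i, ∑ j, (f (c i) - c i * dslope f (c i) (c j)) * ∑ k, M k i j
        - ∑ i, ∑ j, dslope f (c i) (c j) * ∑ k, x k * M k i j := by
  have h1 : ∑ i, ∑ j, (f (c i) - c i * dslope f (c i) (c j)) * ∑ k, M k i j =
      ∑ k, ∑ i, ∑ j, (f (c i) - c i * dslope f (c i) (c j)) * M k i j := by
    simp only [Finset.mul_sum]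
    refine (Finset.sum_congr rfl fun i _ => Finset.sum_comm).trans ?_
    rw [Finset.sum_comm]
  have h2 : ∑ i, ∑ j, dslope f (c i) (c j) * ∑ k, x k * M k i j =
      ∑ k, ∑ i, ∑ j, dslope f (c i) (c j) * (x k * M k i j) := by
    simp only [Finset.mul_sum]
    refine (Finset.sum_congr rfl fun i _ => Finset.sum_comm).trans ?_
    rw [Finset.sum_comm]
  rw [h1, h2, ← Finset.sum_sub_distrib, ← Finset.sum_sub_distrib]
  refine Finset.sum_congr rfl fun k _ => ?_
  rw [Finset.mul_sum, ← Finset.sum_sub_distrib, ← Finset.sum_sub_distrib]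
  refine Finset.sum_congr rfl fun i _ => ?_
  rw [Finset.mul_sum, ← Finset.sum_sub_distrib, ← Finset.sum_sub_distrib]
  refine Finset.sum_congr rfl fun j _ => ?_
  simp only [secondDiff]
  ring

variable [DecidableEq ι]
variable {H : Type*} [NormedAddCommGroup H] [InnerProductSpace ℂ H]

theorem OrthonormalBasis.exists_of_orthogonal (b : OrthonormalBasis ι ℂ H) {W : ι → ι → ℝ}
    (hW : ∀ k l, ∑ i, W i k * W i l = if k = l then 1 else 0) :
    ∃ w : OrthonormalBasis ι ℂ H, ∀ k, w k = ∑ i, (W i k : ℂ) • b i := by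
  have hon : Orthonormal ℂ fun k => ∑ i, (W i k : ℂ) • b i := by
    rw [orthonormal_iff_ite]
    intro k l
    rw [b.orthonormal.inner_sum]
    simp only [Complex.conj_ofReal, ← Complex.ofReal_mul, ← Complex.ofReal_sum, hW]
    split_ifs <;> simp
  have hcard : Fintype.card ι = Module.finrank ℂ H :=
    (Module.finrank_eq_card_basis b.toBasis).symm
  have hfd := b.toBasis.finiteDimensional_of_finite
  rcases isEmpty_or_nonempty ι with hι | hι
  · exact ⟨b, fun k => isEmptyElim k⟩
  have hsp := (basisOfOrthonormalOfCardEqFinrank hon hcard).span_eq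
  rw [coe_basisOfOrthonormalOfCardEqFinrank] at hsp
  exact ⟨OrthonormalBasis.mk hon hsp.ge, fun k => by simp⟩

variable [CompleteSpace H]

/-- The tangent inequality evaluated at an operator whose eigenbasis is a real rotation of that of
the base point. -/
theorem IsOperatorConvex.sum_secondDiffForm_nonneg [Nontrivial H] {J : Set ℝ}
    (hJ : J.OrdConnected) {f : ℝ → ℝ} (hf : ContinuousOn f J) (h : IsOperatorConvex H J f)
    (b : OrthonormalBasis ι ℂ H) {a : ι → ℝ} (ha : ∀ i, a i ∈ interior J)
    (hd : ∀ i, DifferentiableAt ℝ f (a i)) {x : ι → ℝ} (hx : ∀ k, x k ∈ J) (v : ι → ℝ)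
    {W : ι → ι → ℝ} (hW : ∀ k l, ∑ i, W i k * W i l = if k = l then 1 else 0)
    (hW' : ∀ i j, ∑ k, W i k * W j k = if i = j then 1 else 0) :
    0 ≤ ∑ k, secondDiffForm f a (x k) fun i => v i * W i k := by
  obtain ⟨w, hw⟩ := b.exists_of_orthogonal hW
  have hb := orthonormal_iff_ite.1 b.orthonormal
  have hbw : ∀ i k, inner ℂ (b i) (w k) = (W i k : ℂ) := fun i k => by
    rw [hw, b.orthonormal.inner_right_fintype]
  have hwb : ∀ i k, inner ℂ (w k) (b i) = (W i k : ℂ) := fun i k => by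
    rw [← inner_conj_symm, hbw, Complex.conj_ofReal]
  have hwu : ∀ k, inner ℂ (w k) (∑ i, (v i : ℂ) • b i) = ((∑ i, v i * W i k : ℝ) : ℂ) := by
    intro k
    simp only [inner_sum, inner_smul_right, hwb]
    push_cast
    rfl
  have huw : ∀ k, inner ℂ (∑ i, (v i : ℂ) • b i) (w k) = ((∑ i, v i * W i k : ℝ) : ℂ) := by
    intro k
    rw [← inner_conj_symm, hwu, Complex.conj_ofReal]
  have key := h.tangent_le hJ hf b ha hd (w.diagOp_mem_spOps hx) v
  have hR : (inner ℂ (∑ i, (v i : ℂ) • b i) (cfc f (w.diagOp x) (∑ i, (v i : ℂ) • b i))).re =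
      ∑ k, f (x k) * ∑ i, ∑ j, v i * W i k * (v j * W j k) := by
    rw [w.cfc_diagOp, w.inner_diagOp, Complex.re_sum]
    refine Finset.sum_congr rfl fun k _ => ?_
    rw [huw, hwu, ← Complex.ofReal_mul, ← Complex.ofReal_mul, Complex.ofReal_re,
      Finset.sum_mul_sum]
  have hE : ∀ i j, (inner ℂ (b j) ((w.diagOp x - b.diagOp a) (b i))).re =
      ∑ k, x k * (W i k * W j k) - if i = j then a i else 0 := by
    intro i j
    rw [sub_apply, inner_sub_right, b.diagOp_apply, w.inner_diagOp, inner_smul_right, hb]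
    simp only [hbw, hwb, ← Complex.ofReal_mul, ← Complex.ofReal_sum]
    rw [Complex.sub_re, Complex.ofReal_re]
    congr 1
    · exact Finset.sum_congr rfl fun k _ => by ring
    · by_cases hij : i = j
      · simp [hij]
      · simp [hij, Ne.symm hij]
  rw [hR] at key
  simp only [hE] at key
  have hsum := sum_mul_secondDiff f a x fun k i j => v i * W i k * (v j * W j k)
  have h1 : ∀ i j, ∑ k, v i * W i k * (v j * W j k) = if i = j then v i * v j else 0 := by
    intro i j
    have : ∑ k, v i * W i k * (v j * W j k) = v i * v j * ∑ k, W i k * W j k := by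
      rw [Finset.mul_sum]; exact Finset.sum_congr rfl fun k _ => by ring
    rw [this, hW']
    simp
  have h2 : ∀ i j, ∑ k, x k * (v i * W i k * (v j * W j k)) =
      v i * v j * ∑ k, x k * (W i k * W j k) := by
    intro i j
    rw [Finset.mul_sum]; exact Finset.sum_congr rfl fun k _ => by ring
  simp only [h1, h2] at hsum
  simp only [secondDiffForm]
  rw [hsum]
  simp only [mul_sub, Finset.sum_sub_distrib, mul_ite, mul_zero, Finset.sum_ite_eq,
    Finset.mem_univ, if_true, sub_mul] at key ⊢
  have e1 : ∑ i, ∑ j, v i * v j * dslope f (a i) (a j) * ∑ k, x k * (W i k * W j k) =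
      ∑ i, ∑ j, dslope f (a i) (a j) * (v i * v j * ∑ k, x k * (W i k * W j k)) :=
    Finset.sum_congr rfl fun i _ => Finset.sum_congr rfl fun j _ => by ring
  have e2 : ∑ i, v i * v i * dslope f (a i) (a i) * a i =
      ∑ i, a i * dslope f (a i) (a i) * (v i * v i) :=
    Finset.sum_congr rfl fun i _ => by ring
  have e3 : ∑ i, f (a i) * v i ^ 2 = ∑ i, f (a i) * (v i * v i) :=
    Finset.sum_congr rfl fun i _ => by ring
  rw [e1, e2, e3] at key
  linarith

end SecondDifference

/-! ### Positivity of the kernel and Jensen's inequality in finite dimension -/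

section FiniteDimensional

open Set Filter Topology

variable {H : Type*} [NormedAddCommGroup H] [InnerProductSpace ℂ H] [CompleteSpace H]
variable {ι : Type*} [Fintype ι]

/-- For an operator convex function on a Hilbert space of dimension `n`, the `n × n` matrices of
second divided differences `f[c i, c j, x]` are positive semidefinite. -/
theorem IsOperatorConvex.secondDiffForm_nonneg [Nontrivial H] {J : Set ℝ}
    (hJ : J.OrdConnected) {f : ℝ → ℝ} (hf : ContinuousOn f J) (h : IsOperatorConvex H J f)
    (b : OrthonormalBasis ι ℂ H) {a : ι → ℝ} (ha : ∀ i, a i ∈ interior J)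
    (hd : ∀ i, DifferentiableAt ℝ f (a i)) {x : ℝ} (hx : x ∈ J) (ξ : ι → ℝ) :
    0 ≤ secondDiffForm f a x ξ := by
  classical
  have : Nonempty ι := b.toBasis.index_nonempty
  let i₀ : ι := Classical.arbitrary ι
  -- Chosen so that the limit vector `ζ 0`, which is η i₀ · e_{i₀} − 2η, equals ξ.
  let η : ι → ℝ := fun i => if i = i₀ then -ξ i else -ξ i / 2
  let p : ℝ → ι → ℝ := fun s i => if i = i₀ then 1 else s
  let τ : ℝ → ℝ := fun s => 2 / ∑ i, p s i ^ 2
  have hp : ∀ s, 0 < ∑ i, p s i ^ 2 := fun s =>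
    Finset.sum_pos' (fun i _ => sq_nonneg _) ⟨i₀, Finset.mem_univ _, by simp [p]⟩
  have hτ : ∀ s, τ s * ∑ i, p s i ^ 2 = 2 := fun s => div_mul_cancel₀ _ (hp s).ne'
  -- The Householder reflection in p; as s → 0 it tends to the reflection in the basis vector of i₀.
  let W : ℝ → ι → ι → ℝ := fun s i k => (if i = k then 1 else 0) - τ s * p s i * p s k
  have hWW : ∀ s k l, ∑ i, W s i k * W s i l = if k = l then 1 else 0 := by
    intro s k l
    have e : ∀ i, W s i k * W s i l = (if i = k then (if i = l then 1 else 0) else 0)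
        - (if i = k then τ s * p s i * p s l else 0) - (if i = l then τ s * p s i * p s k else 0)
        + τ s * p s k * p s l * (τ s * p s i ^ 2) := by
      intro i
      simp only [W]
      split_ifs <;> ring
    simp only [e, Finset.sum_add_distrib, Finset.sum_sub_distrib, Finset.sum_ite_eq',
      Finset.mem_univ, if_true, ← Finset.mul_sum, hτ]
    ring
  have hsymm : ∀ s i k, W s i k = W s k i := by
    intro s i k
    simp only [W, eq_comm (a := i)]
    ring
  have hWW' : ∀ s i j, ∑ k, W s i k * W s j k = if i = j then 1 else 0 := by
    intro s i j
    rw [← hWW s i j]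
    exact Finset.sum_congr rfl fun k _ => by rw [hsymm s i, hsymm s j]
  let v : ℝ → ι → ℝ := fun s i => if i = i₀ then s * η i else η i
  have hvp : ∀ s i, v s i * p s i = s * η i := by
    intro s i
    simp only [v, p]
    split_ifs <;> ring
  let ζ : ℝ → ι → ℝ := fun s i => (if i = i₀ then η i₀ else 0) - τ s * η i
  let F : ℝ → ℝ := fun s => secondDiffForm f a x (ζ s) +
    s ^ 2 * τ s ^ 2 * ∑ k ∈ Finset.univ.erase i₀, secondDiffForm f a (a k) η
  have hF : ∀ s, 0 < s → 0 ≤ F s := by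
    intro s hs
    -- The eigenvalue x sits at i₀ and a k elsewhere. For k ≠ i₀ the part of column k along e_k is
    -- invisible to the form, so these terms are O(s⁴), while the i₀ term is s² times the form at ζ
    -- s. Dividing by s² and letting s → 0 isolates x.
    have hmain := h.sum_secondDiffForm_nonneg hJ hf b ha hd
      (x := fun k => if k = i₀ then x else a k)
      (fun k => by
        show (if k = i₀ then x else a k) ∈ J
        split_ifs
        · exact hx
        · exact interior_subset (ha k)) (v s) (hWW s) (hWW' s)
    have hvW : ∀ i k, v s i * W s i k = (if i = k then v s k else 0) + -(τ s * s * p s k) * η i := by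
      intro i k
      have : v s i * W s i k = (if i = k then v s i else 0) - τ s * (v s i * p s i) * p s k := by
        simp only [W]
        split_ifs <;> ring
      rw [this, hvp]
      by_cases hik : i = k
      · simp only [hik, if_true]; ring
      · simp only [hik, if_false]; ring
    have h0 : (fun i => v s i * W s i i₀) = fun i => s * ζ s i := by
      ext i
      rw [hvW]
      simp only [ζ, v, p, if_true]
      split_ifs <;> ring
    have hk : ∀ k, k ≠ i₀ → secondDiffForm f a (a k) (fun i => v s i * W s i k) =
        s ^ 2 * (s ^ 2 * τ s ^ 2) * secondDiffForm f a (a k) η := by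
      intro k hk
      simp only [hvW]
      rw [secondDiffForm_add_single, secondDiffForm_smul]
      simp only [p, hk, if_false]
      ring
    rw [← Finset.add_sum_erase _ _ (Finset.mem_univ i₀), h0, if_pos rfl, secondDiffForm_smul] at hmain
    have hsum : ∑ k ∈ Finset.univ.erase i₀, secondDiffForm f a (if k = i₀ then x else a k)
        (fun i => v s i * W s i k) =
        s ^ 2 * (s ^ 2 * τ s ^ 2) * ∑ k ∈ Finset.univ.erase i₀, secondDiffForm f a (a k) η := by
      rw [Finset.mul_sum]
      refine Finset.sum_congr rfl fun k hk' => ?_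
      rw [if_neg (Finset.ne_of_mem_erase hk'), hk k (Finset.ne_of_mem_erase hk')]
    rw [hsum] at hmain
    have : 0 ≤ s ^ 2 * F s := by
      simp only [F]
      linarith
    exact nonneg_of_mul_nonneg_right this (by positivity)
  have hpc : ∀ i, Continuous fun s => p s i := by
    intro i
    simp only [p]
    split_ifs <;> fun_prop
  have hτc : Continuous τ :=
    continuous_const.div (by fun_prop) fun s => (hp s).ne'
  have hFc : Continuous F := by
    simp only [F, secondDiffForm, ζ]
    fun_prop
  have hlim : Tendsto F (𝓝[>] 0) (𝓝 (F 0)) := (hFc.tendsto 0).mono_left nhdsWithin_le_nhds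
  have hF0 : 0 ≤ F 0 := by
    refine ge_of_tendsto hlim ?_
    filter_upwards [self_mem_nhdsWithin] with s hs using hF s hs
  have hτ0 : τ 0 = 2 := by
    have : ∑ i, p 0 i ^ 2 = 1 := by simp [p, ite_pow]
    simp [τ, this]
  have hζ : ζ 0 = ξ := by
    ext i
    simp only [ζ, hτ0, η]
    by_cases hi : i = i₀
    · simp only [hi, if_true]; ring
    · simp only [hi, if_false]; ring
  simpa [F, hζ] using hF0

/-- Jensen's inequality for a finite resolution of the identity `∑ k, w k ⊗ (w k)⋆ = 1`, relative to
tangents of `f` at points of differentiability. -/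
theorem IsOperatorConvex.sum_tangent_le [Nontrivial H] {J : Set ℝ}
    (hJ : J.OrdConnected) {f : ℝ → ℝ} (hf : ContinuousOn f J) (h : IsOperatorConvex H J f)
    (b : OrthonormalBasis ι ℂ H) {c : ι → ℝ} (hc : ∀ i, c i ∈ interior J)
    (hd : ∀ i, DifferentiableAt ℝ f (c i)) {κ : Type*} [Fintype κ] {x : κ → ℝ}
    (hx : ∀ k, x k ∈ J) {w : κ → H} {a : ι → ℝ}
    (hw : ∀ y z, ∑ k, inner ℂ y (w k) * inner ℂ (w k) z = inner ℂ y z)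
    (hxw : ∀ y z, ∑ k, (x k : ℂ) * (inner ℂ y (w k) * inner ℂ (w k) z) =
      inner ℂ y (b.diagOp a z)) (u : H) :
    ∑ i, ‖inner ℂ (b i) u‖ ^ 2 * (f (c i) + deriv f (c i) * (a i - c i)) ≤
      ∑ k, f (x k) * ‖inner ℂ (w k) u‖ ^ 2 := by
  classical
  have hb := orthonormal_iff_ite.1 b.orthonormal
  let ζ : κ → ι → ℂ := fun k i => inner ℂ (w k) (b i) * inner ℂ (b i) u
  let M : κ → ι → ι → ℝ := fun k i j => (starRingEnd ℂ (ζ k i) * ζ k j).re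
  have hMre : ∀ k i j, M k i j = (ζ k i).re * (ζ k j).re + (ζ k i).im * (ζ k j).im := by
    intro k i j
    simp [M, Complex.mul_re]
  have hpos : 0 ≤ ∑ k, ∑ i, ∑ j, M k i j * secondDiff f c (x k) i j := by
    refine Finset.sum_nonneg fun k _ => ?_
    -- The kernel is real, so the form at a complex vector splits into its real and imaginary parts.
    have e : ∑ i, ∑ j, M k i j * secondDiff f c (x k) i j =
        secondDiffForm f c (x k) (fun i => (ζ k i).re) +
          secondDiffForm f c (x k) (fun i => (ζ k i).im) := by
      simp only [secondDiffForm, ← Finset.sum_add_distrib]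
      refine Finset.sum_congr rfl fun i _ => Finset.sum_congr rfl fun j _ => ?_
      rw [hMre]
      ring
    rw [e]
    exact add_nonneg (h.secondDiffForm_nonneg hJ hf b hc hd (hx k) _)
      (h.secondDiffForm_nonneg hJ hf b hc hd (hx k) _)
  rw [sum_mul_secondDiff] at hpos
  have hζsum : ∀ k, ∑ i, ζ k i = inner ℂ (w k) u := fun k => b.sum_inner_mul_inner (w k) u
  have h1 : ∀ k, ∑ i, ∑ j, M k i j = ‖inner ℂ (w k) u‖ ^ 2 := by
    intro k
    simp only [M, ← Complex.re_sum, ← Finset.mul_sum, ← Finset.sum_mul, ← map_sum, hζsum]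
    rw [mul_comm, Complex.mul_conj, Complex.ofReal_re, Complex.normSq_eq_norm_sq]
  have hMk : ∀ k i j, starRingEnd ℂ (ζ k i) * ζ k j =
      (starRingEnd ℂ (inner ℂ (b i) u) * inner ℂ (b j) u) *
        (inner ℂ (b i) (w k) * inner ℂ (w k) (b j)) := by
    intro k i j
    simp only [ζ, map_mul, inner_conj_symm]
    ring
  have hnorm : ∀ i, (starRingEnd ℂ (inner ℂ (b i) u) * inner ℂ (b i) u).re =
      ‖inner ℂ (b i) u‖ ^ 2 := by
    intro i
    rw [mul_comm, Complex.mul_conj, Complex.ofReal_re, Complex.normSq_eq_norm_sq]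
  have h2 : ∀ i j, ∑ k, M k i j = if i = j then ‖inner ℂ (b i) u‖ ^ 2 else 0 := by
    intro i j
    simp only [M, ← Complex.re_sum, hMk, ← Finset.mul_sum, hw, hb]
    by_cases hij : i = j
    · subst hij
      rw [if_pos rfl, if_pos rfl, mul_one, hnorm]
    · simp [hij]
  have h3 : ∀ i j, ∑ k, x k * M k i j = if i = j then a i * ‖inner ℂ (b i) u‖ ^ 2 else 0 := by
    intro i j
    have e : ∀ k, x k * M k i j = ((starRingEnd ℂ (inner ℂ (b i) u) * inner ℂ (b j) u) *
        ((x k : ℂ) * (inner ℂ (b i) (w k) * inner ℂ (w k) (b j)))).re := by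
      intro k
      rw [mul_left_comm, Complex.re_ofReal_mul, ← hMk]
    simp only [e, ← Complex.re_sum, ← Finset.mul_sum, hxw, b.diagOp_apply, inner_smul_right, hb]
    by_cases hij : i = j
    · subst hij
      rw [if_pos rfl, if_pos rfl, mul_one, mul_comm, Complex.re_ofReal_mul, hnorm]
    · simp [hij]
  -- Both moments are diagonal in the basis b, so only the diagonal divided differences, the
  -- derivatives, remain.
  simp only [h1, h2, h3, mul_ite, mul_zero, Finset.sum_ite_eq, Finset.mem_univ, if_true,
    dslope_same] at hpos
  have e : ∑ i, ‖inner ℂ (b i) u‖ ^ 2 * (f (c i) + deriv f (c i) * (a i - c i)) =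
      ∑ i, (f (c i) - c i * deriv f (c i)) * ‖inner ℂ (b i) u‖ ^ 2 +
        ∑ i, deriv f (c i) * (a i * ‖inner ℂ (b i) u‖ ^ 2) := by
    rw [← Finset.sum_add_distrib]
    exact Finset.sum_congr rfl fun i _ => by ring
  rw [e]
  linarith

/-- Operator convexity tested on scalar multiples of the identity. -/
theorem IsOperatorConvex.convexOn [Nontrivial H] {J : Set ℝ} (hJ : J.OrdConnected) {f : ℝ → ℝ}
    (hf : ContinuousOn f J) (h : IsOperatorConvex H J f) : ConvexOn ℝ J f := by
  refine convexOn_of_midpoint hJ hf fun x hx y hy => ?_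
  have hmem : ∀ z ∈ J, algebraMap ℝ (H →L[ℂ] H) z ∈ spOps H J := fun z hz =>
    ⟨.algebraMap _ (IsSelfAdjoint.all z), by
      rw [spectrum.scalar_eq]; exact singleton_subset_iff.2 hz⟩
  obtain ⟨u, hu⟩ := exists_ne (0 : H)
  have h1 := h _ (hmem x hx) _ (hmem y hy)
  have e : ∀ r s : ℝ, (1 / 2 : ℝ) • (algebraMap ℝ (H →L[ℂ] H) r + algebraMap ℝ (H →L[ℂ] H) s) =
      algebraMap ℝ (H →L[ℂ] H) ((r + s) / 2) := by
    intro r s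
    rw [← map_add, Algebra.algebraMap_eq_smul_one, Algebra.algebraMap_eq_smul_one, smul_smul]
    congr 1
    ring
  rw [e, cfc_algebraMap, cfc_algebraMap, cfc_algebraMap, e] at h1
  have h2 := ContinuousLinearMap.re_inner_le_of_le h1 u
  have h3 : ∀ r : ℝ, (inner ℂ u (algebraMap ℝ (H →L[ℂ] H) r u)).re = r * ‖u‖ ^ 2 := by
    intro r
    rw [Algebra.algebraMap_eq_smul_one, smul_apply, one_apply_eq_self, ← Complex.coe_smul,
      inner_smul_right, Complex.re_ofReal_mul, inner_self_eq_norm_sq_to_K]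
    norm_cast
  rw [h3, h3] at h2
  exact le_of_mul_le_mul_right h2 (by positivity)

theorem re_inner_mul_inner_symm {H : Type*} [NormedAddCommGroup H] [InnerProductSpace ℂ H]
    (u w : H) : (inner ℂ u w * inner ℂ w u).re = ‖inner ℂ w u‖ ^ 2 := by
  rw [← inner_conj_symm u w, mul_comm, Complex.mul_conj, Complex.ofReal_re,
    Complex.normSq_eq_norm_sq]

/-- A degenerate interval has no interior in which to take tangents, but f is then constant on all
spectra and both sides agree. -/
theorem operatorJensen_of_subsingleton {J : Set ℝ} (hJ : J.OrdConnected)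
    (hJs : J.Subsingleton) (f : ℝ → ℝ) :
    OperatorJensen H J f := by
  intro n X C hX hC
  obtain ⟨c, hc⟩ : ∃ c, J ⊆ {c} := by
    rcases hJs.eq_empty_or_singleton with rfl | ⟨c, rfl⟩
    · exact ⟨0, empty_subset _⟩
    · exact ⟨c, Subset.rfl⟩
  have hcfc : ∀ Z ∈ spOps H J, cfc f Z = algebraMap ℝ (H →L[ℂ] H) (f c) := by
    intro Z hZ
    rw [← cfc_const (f c) Z hZ.1]
    exact cfc_congr fun y hy => by rw [mem_singleton_iff.1 (hc (hZ.2 hy))]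
  have hX' : ∑ i, star (C i) * cfc f (X i) * C i = algebraMap ℝ (H →L[ℂ] H) (f c) := by
    rw [← sum_conj_algebraMap hC (f c)]
    exact Finset.sum_congr rfl fun i _ => by rw [hcfc _ (hX i)]
  have hZ := sum_conj_mem_spOps hJ hX hC
  rw [hX', hcfc _ hZ]

theorem IsOperatorConvex.operatorJensen_of_finite [FiniteDimensional ℂ H] {J : Set ℝ}
    (hJ : J.OrdConnected) {f : ℝ → ℝ} (hf : ContinuousOn f J) (h : IsOperatorConvex H J f) :
    OperatorJensen H J f := by
  rcases subsingleton_or_nontrivial H with hH | hH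
  · intro n X C _ _
    exact (Subsingleton.elim _ _).le
  rcases J.subsingleton_or_nontrivial with hs | hnt
  · exact operatorJensen_of_subsingleton hJ hs f
  have hint : (interior J).Nonempty := by
    obtain ⟨x, hx, y, hy, hxy⟩ := hnt.exists_lt
    obtain ⟨z, hz⟩ := exists_between hxy
    exact ⟨z, interior_maximal (Ioo_subset_Icc_self.trans (hJ.out hx hy)) isOpen_Ioo hz⟩
  have hconv := h.convexOn hJ hf
  intro n X C hX hC
  choose β x hXd hxJ using fun m => exists_eq_diagOp (hX m)
  have hZmem := sum_conj_mem_spOps hJ hX hC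
  obtain ⟨b, a, hZ, ha⟩ := exists_eq_diagOp hZmem
  -- The spectral decompositions of the X m split the sum into rank-one pieces along the vectors C
  -- m⋆ β m k; taking g = 1 and g = x gives the two moment conditions.
  have hform : ∀ (g : Fin n → Fin (Module.finrank ℂ H) → ℝ) (y z : H),
      inner ℂ y ((∑ m, star (C m) * (β m).diagOp (g m) * C m) z) =
        ∑ k : Fin n × Fin (Module.finrank ℂ H), (g k.1 k.2 : ℂ) *
          (inner ℂ y (star (C k.1) (β k.1 k.2)) * inner ℂ (star (C k.1) (β k.1 k.2)) z) := by
    intro g y z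
    rw [Fintype.sum_prod_type, sum_apply, inner_sum]
    refine Finset.sum_congr rfl fun m _ => ?_
    rw [mul_apply_eq_comp, mul_apply_eq_comp, ContinuousLinearMap.star_eq_adjoint,
      ContinuousLinearMap.adjoint_inner_right, OrthonormalBasis.inner_diagOp]
    refine Finset.sum_congr rfl fun k _ => ?_
    rw [ContinuousLinearMap.star_eq_adjoint, ContinuousLinearMap.adjoint_inner_right,
      ContinuousLinearMap.adjoint_inner_left]
  refine ContinuousLinearMap.le_of_re_inner_le (cfc_predicate f _)
    (isSelfAdjoint_sum_conj fun i => cfc_predicate f (X i)) fun u => ?_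
  have hR : (inner ℂ u ((∑ m, star (C m) * cfc f (X m) * C m) u)).re =
      ∑ k : Fin n × Fin (Module.finrank ℂ H), f (x k.1 k.2) *
        ‖inner ℂ (star (C k.1) (β k.1 k.2)) u‖ ^ 2 := by
    have e : ∀ m, cfc f (X m) = (β m).diagOp fun i => f (x m i) := fun m => by
      rw [hXd m, OrthonormalBasis.cfc_diagOp]
    simp only [e]
    rw [hform fun m i => f (x m i), Complex.re_sum]
    refine Finset.sum_congr rfl fun k _ => ?_
    rw [Complex.re_ofReal_mul, re_inner_mul_inner_symm]
  have hL : (inner ℂ u (cfc f (∑ m, star (C m) * X m * C m) u)).re =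
      ∑ i, ‖inner ℂ (b i) u‖ ^ 2 * f (a i) := by
    rw [hZ, OrthonormalBasis.cfc_diagOp, OrthonormalBasis.inner_diagOp, Complex.re_sum]
    refine Finset.sum_congr rfl fun k _ => ?_
    rw [Complex.re_ofReal_mul, re_inner_mul_inner_symm,
      mul_comm]
  have hw : ∀ y z, ∑ k : Fin n × Fin (Module.finrank ℂ H),
      inner ℂ y (star (C k.1) (β k.1 k.2)) * inner ℂ (star (C k.1) (β k.1 k.2)) z =
        inner ℂ y z := by
    intro y z
    have h1 := hform (fun _ _ => 1) y z
    have h2 : ∀ m, (β m).diagOp (fun _ => 1) = 1 := fun m =>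
      (β m).continuousLinearMap_ext fun k => by rw [OrthonormalBasis.diagOp_apply]; simp
    simp only [h2, mul_one, hC, Complex.ofReal_one, one_mul] at h1
    exact h1.symm
  have hxw : ∀ y z, ∑ k : Fin n × Fin (Module.finrank ℂ H), (x k.1 k.2 : ℂ) *
      (inner ℂ y (star (C k.1) (β k.1 k.2)) * inner ℂ (star (C k.1) (β k.1 k.2)) z) =
        inner ℂ y (b.diagOp a z) := by
    intro y z
    rw [← hform x, ← hZ]
    simp only [← hXd]
  rw [hL, hR]
  refine le_of_forall_pos_le_add fun ε hε => ?_
  -- The tangent errors are weighted by |⟨b i, u⟩|², of total ‖u‖²; the + 1 covers u = 0.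
  have hε' : 0 < ε / (‖u‖ ^ 2 + 1) := by positivity
  choose c hc hd htan using fun i => hconv.exists_tangent_ge hf hint (ha i) hε'
  have hmain := h.sum_tangent_le hJ hf b hc hd (fun k => hxJ k.1 k.2) hw hxw u
  have hsq : ∑ i, ‖inner ℂ (b i) u‖ ^ 2 = ‖u‖ ^ 2 := b.sum_sq_norm_inner_right u
  have h1 : ∑ i, ‖inner ℂ (b i) u‖ ^ 2 * (f (a i) - ε / (‖u‖ ^ 2 + 1)) ≤
      ∑ i, ‖inner ℂ (b i) u‖ ^ 2 * (f (c i) + deriv f (c i) * (a i - c i)) :=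
    Finset.sum_le_sum fun i _ => mul_le_mul_of_nonneg_left (htan i) (by positivity)
  simp only [mul_sub, Finset.sum_sub_distrib, ← Finset.sum_mul, hsq] at h1 hmain
  have h2 : ‖u‖ ^ 2 * (ε / (‖u‖ ^ 2 + 1)) ≤ ε := by
    rw [mul_div_assoc', div_le_iff₀ (by positivity)]
    nlinarith
  linarith

end FiniteDimensional

theorem theorem2p1 (H : Type*) [NormedAddCommGroup H] [InnerProductSpace ℂ H] [CompleteSpace H]
    (J : Set ℝ) (hJ : J.OrdConnected) (f : ℝ → ℝ) (hf : ContinuousOn f J) :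
    IsOperatorConvex H J f ↔ IsCStarConvex (H →L[ℂ] H) (operatorEpigraph H J f) := by
  refine ⟨fun h => isCStarConvex_of_operatorJensen hJ ?_, isOperatorConvex_of_isCStarConvex⟩
  by_cases hH : FiniteDimensional ℂ H
  · exact h.operatorJensen_of_finite hJ hf
  · exact h.operatorJensen_of_infinite hH hJ hf
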